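/- Let $\mathbb K$ be a field; all homology is taken with coefficients in $\mathbb K$. An (abstract simplicial) complex on a set $V$ is a family of finite subsets of $V$ closed under taking subsets (elements of $V$ need not be vertices of it); it is non-void if it contains $\emptyset$, and $\emptyset$ is a face of dimension $-1$, so that $\tilde H_{-1}(\{\emptyset\})=\mathbb K$. For a complex $K$ write $K(k)$ for the set of its $k$-dimensional faces, $K[S]=\{\tau\in K:\tau\subset S\}$ for the induced subcomplex on $S\subset V$, and $\mathrm{lk}(K,\sigma)=\{\tau\in K:\tau\cup\sigma\in K,\ \tau\cap\sigma=\emptyset\}$ for the link of $\sigma$. **Proposition 2.1.** Let $X$ and $Y$ be two non-void complexes on the same vertex set $V$, with $\dim Y=n$. Then there exists a homology spectral sequence $\{E^r_{p,q}\}_{r\ge 1}$ of $\mathbb K$-vector spaces, $p,q\in\mathbb Z$, with differentials $d^r:E^r_{p,q}\to E^r_{p-r,q+r-1}$, which converges to $H_*(Y,X\cap Y)$, and such that for $0\le p\le n$ and all $q\in\mathbb Z$ $$E^1_{p,q}\;\cong\bigoplus_{\sigma\in Y(n-p)}\ \bigoplus_{\substack{i,j\ge 0\\ i+j=p+q}}\tilde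 H_{i-1}(X[\sigma])\otimes_{\mathbb K}\tilde H_{j-1}(\mathrm{lk}(Y,\sigma)),$$ while $E^1_{p,q}=0$ for $p<0$ and for $p>n$. Here convergence means that each $H_m(Y,X\cap Y)$ has a finite increasing filtration $\{F_pH_m\}_{p\in\mathbb Z}$, from $0$ to $H_m(Y,X\cap Y)$, such that for all $p,q$ and all sufficiently large $r$ the differentials $d^r$ into and out of $E^r_{p,q}$ vanish and $E^r_{p,q}\cong F_pH_{p+q}/F_{p-1}H_{p+q}$. -/

import Mathlib

open CategoryTheory

universe u v w

namespace SimplicialHomology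

/-- An abstract simplicial complex on the vertex set `V`: a family of finite subsets of `V`
closed under passing to subsets. The void complex (no faces at all) and the empty complex (whose
only face is `∅`) are different, and not every element of `V` has to be a face. -/
abbrev Complex (V : Type v) := LowerSet (Finset V)

section Combinatorics

variable {V : Type v}

/-- The dimension of a simplex, with `dim ∅ = -1`. -/
def simplexDim (σ : Finset V) : ℤ := (σ.card : ℤ) - 1

/-- `dim Y = n`: the largest dimension of a face of `Y` is `n`. -/
def HasDim (Y : Complex V) (n : ℤ) : Prop :=
  IsGreatest {d : ℤ | ∃ σ ∈ Y, simplexDim σ = d} n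

/-- The type `Y(k)` of `k`-dimensional faces of `Y`. -/
abbrev FacesOfDim (Y : Complex V) (k : ℤ) := {σ : Finset V // σ ∈ Y ∧ simplexDim σ = k}

/-- The induced subcomplex `X[S] = {τ ∈ X : τ ⊆ S}`. -/
def induced (X : Complex V) (S : Finset V) : Complex V where
  carrier := {τ | τ ∈ X ∧ τ ⊆ S}
  lower' := fun _ _ hba ha => ⟨X.lower hba ha.1, subset_trans hba ha.2⟩

/-- The link `lk(X, A) = {τ ∈ X : τ ∪ A ∈ X, τ ∩ A = ∅}`. -/
def link [DecidableEq V] (X : Complex V) (A : Finset V) : Complex V where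
  carrier := {τ | τ ∈ X ∧ τ ∪ A ∈ X ∧ τ ∩ A = ∅}
  lower' := fun _ _ hba ha =>
    ⟨X.lower hba ha.1, X.lower (Finset.union_subset_union_left hba) ha.2.1,
      Finset.subset_empty.mp (ha.2.2 ▸ Finset.inter_subset_inter_right hba)⟩

end Combinatorics

section Chains

variable (K : Type u) [Field K] {V : Type v}

/-- The `i`-chains of `X` with coefficients in `K`: linear combinations of `i`-dimensional faces
of `X`. For `i = -1` the empty face is included. -/
def chains (X : Complex V) (i : ℤ) : Submodule K (Finset V →₀ K) :=
  Finsupp.supported K K {σ | σ ∈ X ∧ simplexDim σ = i}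

theorem chains_mono {X Y : Complex V} (h : X ≤ Y) (i : ℤ) : chains K X i ≤ chains K Y i :=
  Finsupp.supported_mono fun _ hσ => ⟨h hσ.1, hσ.2⟩

variable [LinearOrder V]

/-- The boundary of oriented simplices: for `σ = {v₀ < ⋯ < vₖ}`,
`∂ σ = ∑ᵢ (-1)ⁱ (σ ∖ {vᵢ})`. In particular `∂ {v} = ∅` and `∂ ∅ = 0`. -/
noncomputable def boundary : (Finset V →₀ K) →ₗ[K] (Finset V →₀ K) :=
  Finsupp.linearCombination K fun σ : Finset V =>
    ∑ v ∈ σ, Finsupp.single (σ.erase v) ((-1 : K) ^ (σ.filter (· < v)).card)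

theorem boundary_single (σ : Finset V) (a : K) :
    boundary K (Finsupp.single σ a) =
      a • ∑ v ∈ σ, Finsupp.single (σ.erase v) ((-1 : K) ^ (σ.filter (· < v)).card) := by
  simp [boundary]

theorem sign_swap (σ : Finset V) {v w : V} (hv : v ∈ σ) (hvw : v < w) :
    (-1 : K) ^ (σ.filter (· < v)).card * (-1) ^ ((σ.erase v).filter (· < w)).card +
      (-1) ^ (σ.filter (· < w)).card * (-1) ^ ((σ.erase w).filter (· < v)).card = 0 := by
  have h1 : (σ.erase w).filter (· < v) = σ.filter (· < v) := by
    ext x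
    simp only [Finset.mem_filter, Finset.mem_erase]
    constructor
    · rintro ⟨⟨_, h⟩, h'⟩
      exact ⟨h, h'⟩
    · rintro ⟨h, h'⟩
      exact ⟨⟨(h'.trans hvw).ne, h⟩, h'⟩
  have h2 : (σ.erase v).filter (· < w) = (σ.filter (· < w)).erase v := by
    ext x
    simp only [Finset.mem_filter, Finset.mem_erase]
    tauto
  have h3 : v ∈ σ.filter (· < w) := Finset.mem_filter.mpr ⟨hv, hvw⟩
  rw [h1, h2, ← Finset.card_erase_add_one h3, pow_succ]
  ring

theorem boundary_boundary (c : Finset V →₀ K) : boundary K (boundary K c) = 0 := by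
  suffices h : (boundary K).comp (boundary K) = (0 : (Finset V →₀ K) →ₗ[K] (Finset V →₀ K)) from
    LinearMap.congr_fun h c
  refine Finsupp.lhom_ext fun σ a => ?_
  rw [LinearMap.comp_apply, boundary_single, map_smul, map_sum]
  simp only [boundary_single, Finset.smul_sum, Finsupp.smul_single, smul_eq_mul,
    LinearMap.zero_apply]
  rw [Finset.sum_sigma']
  refine Finset.sum_involution (fun p _ => ⟨p.2, p.1⟩) ?_ ?_ ?_ ?_
  · rintro ⟨v, w⟩ hp
    obtain ⟨hv, hw⟩ := Finset.mem_sigma.mp hp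
    obtain ⟨hne, hw⟩ := Finset.mem_erase.mp hw
    dsimp only at hv hw hne ⊢
    rw [Finset.erase_right_comm (a := w), ← Finsupp.single_add, ← mul_add]
    rcases lt_or_gt_of_ne hne with h | h
    · rw [add_comm, sign_swap K σ hw h, mul_zero, Finsupp.single_zero]
    · rw [sign_swap K σ hv h, mul_zero, Finsupp.single_zero]
  · rintro ⟨v, w⟩ hp _ heq
    obtain ⟨_, hw⟩ := Finset.mem_sigma.mp hp
    exact (Finset.mem_erase.mp hw).1 (congrArg Sigma.fst heq)
  · rintro ⟨v, w⟩ hp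
    obtain ⟨hv, hw⟩ := Finset.mem_sigma.mp hp
    obtain ⟨hne, hw⟩ := Finset.mem_erase.mp hw
    exact Finset.mem_sigma.mpr ⟨hw, Finset.mem_erase.mpr ⟨hne.symm, hv⟩⟩
  · rintro ⟨v, w⟩ _
    rfl

theorem boundary_mem_chains (X : Complex V) {i j : ℤ} (hij : j + 1 = i) (c : Finset V →₀ K)
    (hc : c ∈ chains K X i) : boundary K c ∈ chains K X j := by
  rw [boundary, Finsupp.linearCombination_apply]
  refine Submodule.sum_mem _ fun σ hσ => Submodule.smul_mem _ _ ?_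
  refine Submodule.sum_mem _ fun v hv => Finsupp.single_mem_supported K _ ?_
  obtain ⟨h1, h2⟩ := (Finsupp.mem_supported K c).mp hc hσ
  refine ⟨X.lower (Finset.erase_subset v σ) h1, ?_⟩
  have h3 := Finset.card_erase_add_one hv
  simp only [simplexDim] at h2 ⊢
  omega

/-- The augmented oriented simplicial chain complex of `X`, with `K`-coefficients;
its homology is the reduced homology of `X`. -/
noncomputable def reducedChainComplex (X : Complex V) :
    ChainComplex (ModuleCat.{max u v} K) ℤ where
  X i := ModuleCat.of K (chains K X i)
  d i j :=
    if h : j + 1 = i then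
      ModuleCat.ofHom ((boundary K).restrict (boundary_mem_chains K X h))
    else 0
  shape i j h := dif_neg h
  d_comp_d' i j k hij hjk := by
    have hij' : j + 1 = i := hij
    have hjk' : k + 1 = j := hjk
    rw [dif_pos hij', dif_pos hjk', ← ModuleCat.ofHom_comp]
    refine ModuleCat.hom_ext (LinearMap.ext fun c => Subtype.ext ?_)
    exact boundary_boundary K c.1

/-- The map of chain complexes induced by the inclusion of a subcomplex. -/
noncomputable def inclusionMap {A Y : Complex V} (h : A ≤ Y) :
    reducedChainComplex K A ⟶ reducedChainComplex K Y where
  f i := ModuleCat.ofHom (Submodule.inclusion (chains_mono K h i))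
  comm' i j hij := by
    have hij' : j + 1 = i := hij
    simp only [reducedChainComplex, dif_pos hij', ← ModuleCat.ofHom_comp]
    rfl

/-- The chain complex `C(Y) / C(A)` of a pair `A ≤ Y`. If `∅ ∈ A` then the empty face is killed,
so that this is the usual relative chain complex, the quotient of the ordinary
(non-augmented) chain complexes. -/
noncomputable def relativeChainComplex {A Y : Complex V} (h : A ≤ Y) :
    ChainComplex (ModuleCat.{max u v} K) ℤ :=
  Limits.cokernel (inclusionMap K h)

/-- The reduced homology `H̃ᵢ(X; K)`. -/
noncomputable abbrev reducedHomology (X : Complex V) (i : ℤ) : ModuleCat.{max u v} K :=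
  (reducedChainComplex K X).homology i

/-- The relative homology `Hᵢ(Y, A; K)` of a pair of non-void complexes `A ≤ Y`. -/
noncomputable abbrev relativeHomology {A Y : Complex V} (h : A ≤ Y) (i : ℤ) :
    ModuleCat.{max u v} K :=
  (relativeChainComplex K h).homology i

end Chains

section SpectralSequences

variable (K : Type u) [Field K]

/-- Homology spectral sequences of `K`-vector spaces, starting with the page `E¹`. The
differentials of the page `Eʳ` are `dʳ : Eʳ_{p,q} ⟶ Eʳ_{p-r,q+r-1}`. -/
abbrev HomologySpectralSequence :=
  SpectralSequence (ModuleCat.{w} K) (fun r : ℤ => ComplexShape.up' ((-r, r - 1) : ℤ × ℤ)) 1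

variable {K}

/-- The spectral sequence `E` converges to the graded vector space `H`: every `H m` has a finite
increasing filtration `F m` such that, for all `p` and `q`, the terms `Eʳ_{p,q}` are
eventually stationary (the differentials into and out of them vanish) with stable value
`E^∞_{p,q}` isomorphic to `F_p H_{p+q} / F_{p-1} H_{p+q}`. -/
def ConvergesTo (E : HomologySpectralSequence.{u, w} K) (H : ℤ → ModuleCat.{w} K) : Prop :=
  ∃ F : (m : ℤ) → ℤ → Submodule K (H m),
    (∀ m, Monotone (F m)) ∧
    (∀ m, ∃ a b : ℤ, F m a = ⊥ ∧ F m b = ⊤) ∧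
    ∀ p q : ℤ, ∃ r₀ : ℤ, ∀ (r : ℤ) (hr : 1 ≤ r), r₀ ≤ r →
      (∀ pq : ℤ × ℤ, (E.page r hr).d (p, q) pq = 0 ∧ (E.page r hr).d pq (p, q) = 0) ∧
      Nonempty ((E.page r hr).X (p, q) ≃ₗ[K]
        (F (p + q) p ⧸ (F (p + q) (p - 1)).submoduleOf (F (p + q) p)))

end SpectralSequences

end SimplicialHomology

/-! The spectral sequence comes from a finite filtration of an auxiliary complex whose homology is
that of the pair (Y, X ∩ Y). Its basis consists of the triples (A, σ, B) with A ⊆ σ, A ∉ X, B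
disjoint from σ and σ ∪ B ∈ Y, in degree dim A + |B|. Here A is a relative simplex and (σ, B) stands
for the cube [σ, σ ∪ B] of faces of Y. The differential takes the boundary of A modulo X and the
boundary of the cube: a vertex v of B yields the lower face (σ, B ∖ v) and the upper face (σ ∪ v, B
∖ v), with opposite signs.

Abutment: sending (A, σ, ∅) to A, and everything with B ≠ ∅ to 0, is a surjective chain map onto the
relative chains (`bottomMap`). Its kernel is acyclic because, for fixed A, the faces of Y containing
A form a poset with least element A. Algebraically, filling cubes in the direction of the least
vertex of (σ ∪ B) ∖ A contracts the upper-face part of the differential, and all other terms lower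
the weight |A| + |σ| + |B| (`fillMap_homotopy`, `sub_homotopy_mem`, `exists_totalBoundary_eq`).

First page: filter by n - dim σ. Only upper faces change σ, and they lower the filtration, so the
associated graded complex is the sum over σ of the relative chains of the full simplex on σ modulo
X[σ], tensored with the shifted reduced chains of lk(Y, σ). The simplex on a nonempty σ is acyclic,
so its homology modulo X[σ] is the reduced homology of X[σ] in one degree less, and Künneth gives
the formula (`nonempty_stratumContraction`, `strataFirstPageEquiv`). Künneth itself is proved with
contractions: over a field a complex is homotopy equivalent to its homology, and such equivalences
can be tensored.

Since ∅ ∈ X, every A and hence every σ is nonempty, so 0 ≤ dim σ ≤ n and only 0 ≤ p ≤ n contribute.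
-/

namespace SimplicialHomology

/-! ### Homology presented by representing cycles. -/

section LinearAlgebra

variable {K : Type u} [Field K]

theorem mem_submoduleOf_iff {M : Type*} [AddCommGroup M] [Module K M] {N P : Submodule K M}
    {x : P} : x ∈ N.submoduleOf P ↔ (x : M) ∈ N := Iff.rfl

/-- A surjective linear map with kernel `N` identifies the quotient by `N` with its target. -/
noncomputable def quotientEquivOfSurjective {W X : Type*} [AddCommGroup W] [Module K W]
    [AddCommGroup X] [Module K X] (N : Submodule K W) (f : W →ₗ[K] X)
    (hf : Function.Surjective f) (hN : ∀ x, f x = 0 ↔ x ∈ N) : (W ⧸ N) ≃ₗ[K] X :=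
  (Submodule.quotEquivOfEq N (LinearMap.ker f)
    (Submodule.ext fun x => by rw [LinearMap.mem_ker, hN])).trans
    (f.quotKerEquivOfSurjective hf)

/-- The homology of a short complex of modules, presented by a space of representing cycles. -/
noncomputable def shortComplexHomologyEquiv (S : ShortComplex (ModuleCat.{w} K)) {W : Type*}
    [AddCommGroup W] [Module K W] (N : Submodule K W) (φ : W →ₗ[K] S.X₂)
    (hcycle : ∀ x, S.g (φ x) = 0) (hsurj : ∀ y, S.g y = 0 → ∃ x z, y = φ x + S.f z)
    (hker : ∀ x, (∃ z, S.f z = φ x) ↔ x ∈ N) : (W ⧸ N) ≃ₗ[K] S.homology :=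
  (quotientEquivOfSurjective N
    ((LinearMap.range S.moduleCatToCycles).mkQ ∘ₗ
      φ.codRestrict (LinearMap.ker S.g.hom) hcycle)
    (by
      intro y
      obtain ⟨⟨y, hy⟩, rfl⟩ := Submodule.mkQ_surjective _ y
      obtain ⟨x, z, rfl⟩ := hsurj y hy
      refine ⟨x, ?_⟩
      rw [LinearMap.comp_apply, ← sub_eq_zero, ← map_sub, Submodule.mkQ_apply,
        Submodule.Quotient.mk_eq_zero]
      refine ⟨-z, Subtype.ext ?_⟩
      change S.f.hom (-z) = φ x - (φ x + S.f.hom z)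
      rw [map_neg]
      abel)
    (by
      intro x
      rw [← hker, LinearMap.comp_apply, Submodule.mkQ_apply, Submodule.Quotient.mk_eq_zero]
      constructor
      · rintro ⟨z, hz⟩
        exact ⟨z, congrArg Subtype.val hz⟩
      · rintro ⟨z, hz⟩
        exact ⟨z, Subtype.ext hz⟩)).trans S.moduleCatHomologyIso.toLinearEquiv.symm

end LinearAlgebra

/-! ### Homology of subspaces of one ambient space with a differential. -/

section SubHomology

variable {K : Type u} [Field K] {M : Type w} [AddCommGroup M] [Module K M]

/-- The cycles of the differential `d` in the subspace `P`. -/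
def cyclesIn (d : M →ₗ[K] M) (P : Submodule K M) : Submodule K M := P ⊓ LinearMap.ker d

/-- The homology of `Q ⟶ P ⟶ M` for subspaces `P`, `Q` of a space `M` with differential `d`. -/
abbrev SubHomology (d : M →ₗ[K] M) (P Q : Submodule K M) :=
  ↥(cyclesIn d P) ⧸ (Q.map d).submoduleOf (cyclesIn d P)

/-- The homology of a short complex whose terms are subspaces of a fixed space and whose
morphisms are restrictions of a fixed endomorphism. -/
noncomputable def subHomologyEquiv (d : M →ₗ[K] M) (Q P R : Submodule K M)
    (S : ShortComplex (ModuleCat.{w} K)) (e₁ : S.X₁ ≃ₗ[K] Q) (e₂ : S.X₂ ≃ₗ[K] P)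
    (e₃ : S.X₃ ≃ₗ[K] R) (hf : ∀ x, (e₂ (S.f x) : M) = d (e₁ x))
    (hg : ∀ x, (e₃ (S.g x) : M) = d (e₂ x)) : SubHomology d P Q ≃ₗ[K] S.homology :=
  have hg' : ∀ x, S.g x = 0 ↔ d (e₂ x) = 0 := fun x => by
    rw [← hg, Submodule.coe_eq_zero, e₃.map_eq_zero_iff]
  shortComplexHomologyEquiv S _
    (e₂.symm.toLinearMap ∘ₗ Submodule.inclusion (inf_le_left : cyclesIn d P ≤ P))
    (fun x => (hg' _).2 (by
      rw [LinearMap.comp_apply, LinearEquiv.coe_coe, LinearEquiv.apply_symm_apply]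
      exact x.2.2))
    (fun y hy => ⟨⟨e₂ y, (e₂ y).2, (hg' y).1 hy⟩, 0, by
      rw [map_zero, add_zero]
      exact (e₂.symm_apply_apply y).symm⟩)
    (fun x => by
      rw [mem_submoduleOf_iff, Submodule.mem_map]
      constructor
      · rintro ⟨z, hz⟩
        refine ⟨e₁ z, (e₁ z).2, ?_⟩
        rw [← hf, hz, LinearMap.comp_apply, LinearEquiv.coe_coe, LinearEquiv.apply_symm_apply]
        rfl
      · rintro ⟨z, hz, hzx⟩
        refine ⟨e₁.symm ⟨z, hz⟩, e₂.injective (Subtype.ext ?_)⟩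
        rw [hf, LinearEquiv.apply_symm_apply, LinearMap.comp_apply, LinearEquiv.coe_coe,
          LinearEquiv.apply_symm_apply]
        exact hzx)

/-- The homology of a chain complex whose terms are subspaces of a fixed space and whose
differential is a restriction of a fixed endomorphism. -/
noncomputable def chainComplexHomologyEquiv (C : ChainComplex (ModuleCat.{w} K) ℤ)
    (d : M →ₗ[K] M) (P : ℤ → Submodule K M) (e : ∀ i, C.X i ≃ₗ[K] P i)
    (he : ∀ i j, j + 1 = i → ∀ x, (e j (C.d i j x) : M) = d (e i x)) (i : ℤ) :
    SubHomology d (P i) (P (i + 1)) ≃ₗ[K] C.homology i :=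
  (subHomologyEquiv d (P (i + 1)) (P i) (P (i - 1)) (C.sc' (i + 1) i (i - 1)) (e (i + 1)) (e i)
    (e (i - 1)) (he _ _ rfl) (he _ _ (by ring))).trans
    (ShortComplex.homologyMapIso (C.isoSc' (i + 1) i (i - 1) (by simp) (by simp))).symm.toLinearEquiv

end SubHomology

/-! ### The spectral sequence of a filtered complex. -/

section FilteredModule

variable {K : Type u} [Field K] {M : Type w} [AddCommGroup M] [Module K M]
  (d : M →ₗ[K] M) (F : ℤ → ℤ → Submodule K M)

/-- The elements of filtration `p` and degree `m` whose boundary has filtration `p - r`. -/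
def approxCycles (r p m : ℤ) : Submodule K M := F p m ⊓ (F (p - r) (m - 1)).comap d

/-- The subspace of `approxCycles` that is divided out on the page `r`. -/
def approxBoundaries (r p m : ℤ) : Submodule K M :=
  approxCycles d F (r - 1) (p - 1) m ⊔ (approxCycles d F (r - 1) (p + r - 1) (m + 1)).map d

/-- The term of filtration `p` and total degree `m` on the page `r` of the spectral sequence
of a filtered complex. -/
abbrev PageTerm (r p m : ℤ) :=
  ↥(approxCycles d F r p m) ⧸ (approxBoundaries d F r p m).submoduleOf (approxCycles d F r p m)

variable {d F}

theorem mem_approxCycles {r p m : ℤ} {x : M} :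
    x ∈ approxCycles d F r p m ↔ x ∈ F p m ∧ d x ∈ F (p - r) (m - 1) := Iff.rfl

theorem mem_approxBoundaries {r p m : ℤ} {x : M} :
    x ∈ approxBoundaries d F r p m ↔ ∃ a ∈ approxCycles d F (r - 1) (p - 1) m,
      ∃ y ∈ approxCycles d F (r - 1) (p + r - 1) (m + 1), a + d y = x := by
  simp [approxBoundaries, Submodule.mem_sup]

theorem pageTerm_mk_eq_zero {r p m : ℤ} (x : approxCycles d F r p m) :
    (Submodule.Quotient.mk x : PageTerm d F r p m) = 0 ↔ (x : M) ∈ approxBoundaries d F r p m := by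
  rw [Submodule.Quotient.mk_eq_zero, mem_submoduleOf_iff]

theorem d_mem_approxCycles (hd : ∀ x, d (d x) = 0) {r p m p' m' : ℤ} (hp : p' = p - r)
    (hm : m' = m - 1) {x : M} (hx : x ∈ approxCycles d F r p m) :
    d x ∈ approxCycles d F r p' m' := by
  subst hp hm
  exact mem_approxCycles.2 ⟨hx.2, by rw [hd]; exact zero_mem _⟩

/-- In a + dy the second term is killed by d, and a lies in exactly the space whose image is divided
out at filtration p - r, because (p - r) + r - 1 = p - 1. -/
theorem d_mem_approxBoundaries (hd : ∀ x, d (d x) = 0) {r p m p' m' : ℤ} (hp : p' = p - r)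
    (hm : m' = m - 1) {x : M} (hx : x ∈ approxBoundaries d F r p m) :
    d x ∈ approxBoundaries d F r p' m' := by
  subst hp hm
  obtain ⟨a, ha, y, hy, rfl⟩ := mem_approxBoundaries.1 hx
  refine mem_approxBoundaries.2 ⟨0, zero_mem _, a, ?_, by rw [map_add, hd, zero_add, add_zero]⟩
  rwa [show p - r + r - 1 = p - 1 by ring, show m - 1 + 1 = m by ring]

/-- The differential of the page `r`. -/
noncomputable def pageDifferential (hd : ∀ x, d (d x) = 0) (r p m p' m' : ℤ) (hp : p' = p - r)
    (hm : m' = m - 1) : PageTerm d F r p m →ₗ[K] PageTerm d F r p' m' :=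
  Submodule.mapQ _ _ (d.restrict fun _ hx => d_mem_approxCycles hd hp hm hx)
    fun _ hx => d_mem_approxBoundaries hd hp hm hx

theorem pageDifferential_mk (hd : ∀ x, d (d x) = 0) {r p m p' m' : ℤ} (hp : p' = p - r)
    (hm : m' = m - 1) (x : approxCycles d F r p m) :
    pageDifferential (F := F) hd r p m p' m' hp hm (Submodule.Quotient.mk x) =
      Submodule.Quotient.mk ⟨d x, d_mem_approxCycles hd hp hm x.2⟩ := rfl

theorem approxCycles_le_succ (hF : ∀ m, Monotone fun p => F p m) (r p m : ℤ) :
    approxCycles d F (r + 1) p m ≤ approxCycles d F r p m :=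
  fun _ hx => ⟨hx.1, hF _ (by lia : p - (r + 1) ≤ p - r) hx.2⟩

/-- The identification of the homology of one page with the next page, on the level of
elements. -/
noncomputable def nextPageEquiv (hd : ∀ x, d (d x) = 0) (hF : ∀ m, Monotone fun p => F p m)
    (r p m : ℤ) (S : ShortComplex (ModuleCat.{w} K))
    (p₁ m₁ p₃ m₃ : ℤ) (hp₁ : p = p₁ - r) (hm₁ : m = m₁ - 1) (hp₃ : p₃ = p - r) (hm₃ : m₃ = m - 1)
    (e₁ : PageTerm d F r p₁ m₁ ≃ₗ[K] S.X₁) (e₂ : PageTerm d F r p m ≃ₗ[K] S.X₂)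
    (e₃ : PageTerm d F r p₃ m₃ ≃ₗ[K] S.X₃)
    (hf : ∀ x, S.f (e₁ x) = e₂ (pageDifferential hd r p₁ m₁ p m hp₁ hm₁ x))
    (hg : ∀ x, S.g (e₂ x) = e₃ (pageDifferential hd r p m p₃ m₃ hp₃ hm₃ x)) :
    PageTerm d F (r + 1) p m ≃ₗ[K] S.homology :=
  shortComplexHomologyEquiv S _
    (e₂.toLinearMap ∘ₗ Submodule.mkQ _ ∘ₗ Submodule.inclusion (approxCycles_le_succ hF r p m))
    (by
      subst hp₃ hm₃
      rintro ⟨x, hx⟩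
      simp only [LinearMap.comp_apply, LinearEquiv.coe_coe]
      rw [hg, Submodule.mkQ_apply, pageDifferential_mk, (pageTerm_mk_eq_zero _).2, map_zero]
      -- The boundary of x already has filtration p - r - 1, so it lies in the first summand of what
      -- is divided out.
      refine mem_approxBoundaries.2 ⟨d x, mem_approxCycles.2 ⟨?_, ?_⟩, 0, zero_mem _, by simp⟩
      · rw [show p - r - 1 = p - (r + 1) by ring]
        exact hx.2
      · rw [hd]
        exact zero_mem _)
    (by
      subst hp₃ hm₃
      intro y hy
      obtain ⟨y, rfl⟩ := e₂.surjective y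
      obtain ⟨⟨x, hx⟩, rfl⟩ := Submodule.mkQ_surjective _ y
      rw [hg, e₃.map_eq_zero_iff, Submodule.mkQ_apply, pageDifferential_mk,
        pageTerm_mk_eq_zero] at hy
      obtain ⟨a, ha, b, hb, hab⟩ := mem_approxBoundaries.1 hy
      rw [show p - r + r - 1 = p - 1 by ring, show m - 1 + 1 = m by ring] at hb
      -- Vanishing of the differential on the class of x means dx = a + db with b of filtration p -
      -- 1. Passing to x - b keeps the class and pushes the boundary down to a, of filtration p - r
      -- - 1.
      have hw : x - b ∈ approxCycles d F (r + 1) p m := by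
        refine mem_approxCycles.2 ⟨sub_mem hx.1 (hF _ (by lia : p - 1 ≤ p) hb.1), ?_⟩
        rw [map_sub, sub_eq_iff_eq_add.2 hab.symm, show p - (r + 1) = p - r - 1 by ring]
        exact ha.1
      refine ⟨⟨x - b, hw⟩, 0, ?_⟩
      rw [map_zero, add_zero]
      refine congrArg e₂ (sub_eq_zero.1 ?_)
      rw [LinearMap.comp_apply, Submodule.mkQ_apply, Submodule.mkQ_apply, ← Submodule.Quotient.mk_sub,
        pageTerm_mk_eq_zero]
      refine mem_approxBoundaries.2 ⟨b, hb, 0, zero_mem _, ?_⟩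
      rw [map_zero, add_zero]
      exact (sub_sub_cancel x b).symm)
    (by
      obtain rfl : p₁ = p + r := by lia
      obtain rfl : m₁ = m + 1 := by lia
      rintro ⟨x, hx⟩
      simp only [LinearMap.comp_apply, LinearEquiv.coe_coe, Submodule.mkQ_apply]
      rw [mem_submoduleOf_iff]
      constructor
      · rintro ⟨z, hz⟩
        obtain ⟨z, rfl⟩ := e₁.surjective z
        obtain ⟨⟨y, hy⟩, rfl⟩ := Submodule.mkQ_surjective _ z
        rw [hf, e₂.injective.eq_iff, Submodule.mkQ_apply, pageDifferential_mk, eq_comm,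
          ← sub_eq_zero, ← Submodule.Quotient.mk_sub, pageTerm_mk_eq_zero] at hz
        obtain ⟨a, ha, b, hb, hab⟩ := mem_approxBoundaries.1 hz
        have hab : a + d b = x - d y := hab
        -- The same a survives to the next page's denominator: da = dx has filtration p - r - 1. The
        -- other term is the boundary of y + b, of filtration p + r.
        have hxy : x = a + d (y + b) := by rw [map_add, add_left_comm, hab]; abel
        refine mem_approxBoundaries.2 ⟨a, mem_approxCycles.2 ⟨ha.1, ?_⟩, y + b, mem_approxCycles.2 ⟨?_, ?_⟩, hxy.symm⟩
        · have := (mem_approxCycles.1 hx).2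
          rw [hxy, map_add, hd, add_zero] at this
          rwa [show p - 1 - (r + 1 - 1) = p - (r + 1) by ring]
        · rw [show p + (r + 1) - 1 = p + r by ring]
          exact add_mem hy.1 (hF _ (by lia : p + r - 1 ≤ p + r) hb.1)
        · have := (mem_approxCycles.1 hb).2
          rw [show p + r - 1 - (r - 1) = p by ring] at this
          have hy := (mem_approxCycles.1 hy).2
          rw [show p + r - r = p by ring] at hy
          rw [map_add, show p + (r + 1) - 1 - (r + 1 - 1) = p by ring]
          exact add_mem hy this
      · intro h
        obtain ⟨a, ha, y, hy, hay⟩ := mem_approxBoundaries.1 h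
        have hay : a + d y = x := hay
        rw [show p + (r + 1) - 1 = p + r by ring, show r + 1 - 1 = r by ring] at hy
        refine ⟨e₁ (Submodule.Quotient.mk ⟨y, hy⟩), ?_⟩
        rw [hf, e₂.injective.eq_iff, pageDifferential_mk, eq_comm, ← sub_eq_zero,
          ← Submodule.Quotient.mk_sub, pageTerm_mk_eq_zero]
        refine mem_approxBoundaries.2 ⟨a, ⟨ha.1, ?_⟩, 0, zero_mem _, ?_⟩
        · exact hF _ (by lia : p - 1 - (r + 1 - 1) ≤ p - 1 - (r - 1)) ha.2
        · rw [map_zero, add_zero]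
          exact eq_sub_of_add_eq hay)

variable (F) in
/-- The page `r` of the spectral sequence of a filtered complex. -/
noncomputable def filteredPage (hd : ∀ x, d (d x) = 0) (r : ℤ) :
    HomologicalComplex (ModuleCat.{w} K) (ComplexShape.up' ((-r, r - 1) : ℤ × ℤ)) where
  X pq := ModuleCat.of K (PageTerm d F r pq.1 (pq.1 + pq.2))
  d pq pq' :=
    if h : pq'.1 = pq.1 - r ∧ pq'.1 + pq'.2 = pq.1 + pq.2 - 1 then
      ModuleCat.ofHom (pageDifferential hd r pq.1 (pq.1 + pq.2) pq'.1 (pq'.1 + pq'.2) h.1 h.2)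
    else 0
  shape pq pq' h := dif_neg fun h' => h (by
    obtain ⟨p, q⟩ := pq
    obtain ⟨p', q'⟩ := pq'
    simp only [ComplexShape.up'_Rel, Prod.mk_add_mk, Prod.mk.injEq]
    dsimp only at h'
    lia)
  d_comp_d' i j k hij hjk := by
    split_ifs
    · rw [← ModuleCat.ofHom_comp]
      refine ModuleCat.hom_ext (LinearMap.ext fun x => ?_)
      obtain ⟨x, rfl⟩ := Submodule.mkQ_surjective _ x
      rw [ModuleCat.hom_ofHom, LinearMap.comp_apply, Submodule.mkQ_apply, pageDifferential_mk, pageDifferential_mk, ModuleCat.hom_zero,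
        LinearMap.zero_apply, pageTerm_mk_eq_zero]
      simp [hd]
    all_goals simp

variable (F) in
/-- The terms of the pages, with free indices. -/
noncomputable def filteredPageXEquiv (hd : ∀ x, d (d x) = 0) (r : ℤ) (pq : ℤ × ℤ) (p m : ℤ)
    (hp : p = pq.1) (hm : m = pq.1 + pq.2) :
    PageTerm d F r p m ≃ₗ[K] (filteredPage F hd r).X pq := by
  subst hp hm
  exact LinearEquiv.refl K _

variable (F) in
theorem filteredPage_d (hd : ∀ x, d (d x) = 0) (r : ℤ) (pq pq' : ℤ × ℤ) (p m p' m' : ℤ)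
    (hp : p = pq.1) (hm : m = pq.1 + pq.2) (hp' : p' = pq'.1) (hm' : m' = pq'.1 + pq'.2)
    (h₁ : p' = p - r) (h₂ : m' = m - 1) (x : PageTerm d F r p m) :
    (filteredPage F hd r).d pq pq' (filteredPageXEquiv F hd r pq p m hp hm x) =
      filteredPageXEquiv F hd r pq' p' m' hp' hm' (pageDifferential hd r p m p' m' h₁ h₂ x) := by
  subst hp hm hp' hm'
  have h : (filteredPage F hd r).d pq pq' =
      ModuleCat.ofHom (pageDifferential hd r pq.1 (pq.1 + pq.2) pq'.1 (pq'.1 + pq'.2) h₁ h₂) :=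
    dif_pos ⟨h₁, h₂⟩
  rw [h]
  rfl

variable (F) in
/-- The passage from a page to the next one. -/
noncomputable def filteredPageHomologyEquiv (hd : ∀ x, d (d x) = 0)
    (hF : ∀ m, Monotone fun p => F p m) (r p q : ℤ) :
    (filteredPage F hd r).homology (p, q) ≃ₗ[K] PageTerm d F (r + 1) p (p + q) :=
  (ShortComplex.homologyMapIso ((filteredPage F hd r).isoSc' (p + r, q - r + 1) (p, q)
      (p - r, q + r - 1) (ComplexShape.prev_eq' _ (by ext <;> simp))
      (ComplexShape.next_eq' _ (by ext <;> simp <;> ring)))).toLinearEquiv.trans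
    (nextPageEquiv hd hF r p (p + q)
      ((filteredPage F hd r).sc' (p + r, q - r + 1) (p, q) (p - r, q + r - 1))
      (p + r) (p + q + 1) (p - r) (p + q - 1) (by ring) (by ring) rfl rfl
      (filteredPageXEquiv F hd r (p + r, q - r + 1) (p + r) (p + q + 1) rfl (by dsimp; ring))
      (filteredPageXEquiv F hd r (p, q) p (p + q) rfl rfl)
      (filteredPageXEquiv F hd r (p - r, q + r - 1) (p - r) (p + q - 1) rfl (by dsimp; ring))
      (filteredPage_d F hd r _ _ _ _ _ _ _ _ _ _ _ _)
      (filteredPage_d F hd r _ _ _ _ _ _ _ _ _ _ _ _)).symm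

variable (F) in
/-- The spectral sequence of a filtered complex. -/
noncomputable def filteredSpectralSequence (hd : ∀ x, d (d x) = 0)
    (hF : ∀ m, Monotone fun p => F p m) : HomologySpectralSequence.{u, w} K where
  page r _ := filteredPage F hd r
  iso r r' pq hrr' _ :=
    ((filteredPageHomologyEquiv F hd hF r pq.1 pq.2).trans
      (filteredPageXEquiv F hd (r + 1) pq pq.1 (pq.1 + pq.2) rfl rfl)).toModuleIso ≪≫
      eqToIso (by subst hrr'; rfl)

end FilteredModule

/-! ### Convergence for finite filtrations, and a criterion for the first page. -/

section Convergence

variable {K : Type u} [Field K] {M : Type w} [AddCommGroup M] [Module K M]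
  {d : M →ₗ[K] M} {F : ℤ → ℤ → Submodule K M}

theorem subsingleton_pageTerm {r p m : ℤ}
    (h : approxCycles d F r p m ≤ approxBoundaries d F r p m) :
    Subsingleton (PageTerm d F r p m) :=
  Submodule.Quotient.subsingleton_iff.2 (eq_top_iff.2 fun x _ => h x.2)

theorem subsingleton_pageTerm_of_eq_bot {r p m : ℤ} (h : F p m = ⊥) :
    Subsingleton (PageTerm d F r p m) :=
  subsingleton_pageTerm fun x hx => by
    have hx' : x ∈ F p m := hx.1
    rw [h, Submodule.mem_bot] at hx'
    rw [hx']
    exact zero_mem _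

/-- Every x counted at filtration p is then an element of filtration p - 1 with the same condition
on dx, since (p - 1) - (r - 1) = p - r. -/
theorem subsingleton_pageTerm_of_eq_pred {r p m : ℤ} (h : F p m = F (p - 1) m) :
    Subsingleton (PageTerm d F r p m) :=
  subsingleton_pageTerm fun x hx => by
    refine mem_approxBoundaries.2 ⟨x, mem_approxCycles.2 ⟨h ▸ hx.1, ?_⟩, 0, zero_mem _, by simp⟩
    rw [show p - 1 - (r - 1) = p - r by ring]
    exact hx.2

/-- The filtration on homology induced by the filtration of a complex. -/
def homologyFiltration {b : ℤ} {H : ℤ → Type*} [∀ m, AddCommGroup (H m)] [∀ m, Module K (H m)]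
    (π : ∀ m, cyclesIn d (F b m) →ₗ[K] H m) (m p : ℤ) : Submodule K (H m) :=
  ((F p m).comap (cyclesIn d (F b m)).subtype).map (π m)

theorem mem_homologyFiltration {b : ℤ} {H : ℤ → Type*} [∀ m, AddCommGroup (H m)]
    [∀ m, Module K (H m)] {π : ∀ m, cyclesIn d (F b m) →ₗ[K] H m} {m p : ℤ} {y : H m} :
    y ∈ homologyFiltration π m p ↔ ∃ x : cyclesIn d (F b m), (x : M) ∈ F p m ∧ π m x = y := Iff.rfl

/-- The stable value of the spectral sequence of a filtered complex. -/
noncomputable def stablePageTermEquiv {b : ℤ} (hF : ∀ m, Monotone fun p => F p m)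
    (htop : ∀ p m, F p m ≤ F b m) {H : ℤ → Type*} [∀ m, AddCommGroup (H m)]
    [∀ m, Module K (H m)] (π : ∀ m, cyclesIn d (F b m) →ₗ[K] H m)
    (hπ : ∀ m x, π m x = 0 ↔ (x : M) ∈ (F b (m + 1)).map d) {r p m : ℤ}
    (hbot : F (p - r) (m - 1) = ⊥) (hr : F (p + r - 1) (m + 1) = F b (m + 1)) :
    PageTerm d F r p m ≃ₗ[K]
      (homologyFiltration π m p ⧸
        (homologyFiltration π m (p - 1)).submoduleOf (homologyFiltration π m p)) :=
  -- For such r the boundary of an approximate cycle lies in a zero filtration step, so it is a true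
  -- cycle.
  have hcyc : ∀ x ∈ approxCycles d F r p m, d x = 0 := fun x hx => by
    have h := (mem_approxCycles.1 hx).2
    rwa [hbot, Submodule.mem_bot] at h
  quotientEquivOfSurjective _
    (Submodule.mkQ _ ∘ₗ LinearMap.codRestrict _
      (π m ∘ₗ Submodule.inclusion
        (show approxCycles d F r p m ≤ cyclesIn d (F b m) from
          fun x hx => ⟨htop p m hx.1, hcyc x hx⟩))
      (fun x => ⟨_, x.2.1, rfl⟩))
    (by
      intro y
      obtain ⟨⟨y, hy⟩, rfl⟩ := Submodule.mkQ_surjective _ y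
      obtain ⟨x, hx, rfl⟩ := mem_homologyFiltration.1 hy
      refine ⟨⟨x, mem_approxCycles.2 ⟨hx, ?_⟩⟩, rfl⟩
      rw [x.2.2]
      exact zero_mem _)
    (by
      rintro ⟨x, hx⟩
      rw [LinearMap.comp_apply, Submodule.mkQ_apply, Submodule.Quotient.mk_eq_zero,
        mem_submoduleOf_iff, mem_submoduleOf_iff, mem_homologyFiltration]
      constructor
      · rintro ⟨⟨y, hy⟩, hyF, hyx⟩
        have h : π m (⟨x, htop p m hx.1, hcyc x hx⟩ - ⟨y, hy⟩) = 0 := by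
          rw [map_sub, sub_eq_zero]
          exact hyx.symm
        -- The bounding chain z is arbitrary; `hr` ensures that it satisfies the filtration bound in
        -- the second summand.
        obtain ⟨z, hz, hzx⟩ := (hπ _ _).1 h
        have hzx : d z = x - y := hzx
        refine mem_approxBoundaries.2 ⟨y, mem_approxCycles.2 ⟨hyF, ?_⟩, z,
          mem_approxCycles.2 ⟨hr ▸ hz, ?_⟩, ?_⟩
        · rw [hy.2]
          exact zero_mem _
        · rw [hzx, show p + r - 1 - (r - 1) = p by ring, show m + 1 - 1 = m by ring]
          exact sub_mem hx.1 (hF _ (by lia : p - 1 ≤ p) hyF)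
        · rw [hzx]
          exact add_sub_cancel y x
      · intro h
        obtain ⟨a, ha, y, hy, hay⟩ := mem_approxBoundaries.1 h
        have hay : a + d y = x := hay
        have hda : d a = 0 := by
          have := (mem_approxCycles.1 ha).2
          rwa [show p - 1 - (r - 1) = p - r by ring, hbot, Submodule.mem_bot] at this
        refine ⟨⟨a, htop _ _ ha.1, hda⟩, ha.1, ?_⟩
        change π m ⟨a, htop _ _ ha.1, hda⟩ = π m ⟨x, htop p m hx.1, hcyc x hx⟩
        rw [← sub_eq_zero, ← map_sub, hπ]
        refine ⟨-y, neg_mem (htop _ _ hy.1), ?_⟩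
        change d (-y) = a - x
        rw [map_neg, ← hay]
        abel)

/-- The spectral sequence of a complex with a finite filtration converges to the homology of
the complex. -/
theorem filteredSpectralSequence_convergesTo (hd : ∀ x, d (d x) = 0)
    (hF : ∀ m, Monotone fun p => F p m) (a b : ℤ) (hbot : ∀ p m, p < a → F p m = ⊥)
    (htop : ∀ p m, b ≤ p → F p m = F b m) (H : ℤ → ModuleCat.{w} K)
    (e : ∀ m, SubHomology d (F b m) (F b (m + 1)) ≃ₗ[K] H m) :
    ConvergesTo (filteredSpectralSequence F hd hF) H := by
  have hle : ∀ p m, F p m ≤ F b m := fun p m => by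
    rcases le_total p b with h | h
    · exact hF m h
    · exact (htop p m h).le
  let π : ∀ m, cyclesIn d (F b m) →ₗ[K] H m := fun m => (e m).toLinearMap ∘ₗ Submodule.mkQ _
  have hπ : ∀ m x, π m x = 0 ↔ (x : M) ∈ (F b (m + 1)).map d := fun m x => by
    rw [LinearMap.comp_apply, LinearEquiv.coe_coe, (e m).map_eq_zero_iff, Submodule.mkQ_apply,
      Submodule.Quotient.mk_eq_zero, mem_submoduleOf_iff]
  -- The bound on r gives p - r < a, so targets of differentials vanish, and p + r - 1 ≥ b, so the
  -- filtration is already constant where differentials into (p, q) start.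
  refine ⟨homologyFiltration π, fun m p p' hpp' => ?_, fun m => ⟨a - 1, b, ?_, ?_⟩,
    fun p q => ⟨max (p - a + 1) (b - p + 1), fun r hr hr₀ => ⟨fun pq => ⟨?_, ?_⟩, ⟨?_⟩⟩⟩⟩
  · rintro _ ⟨x, hx, rfl⟩
    exact ⟨x, hF m hpp' hx, rfl⟩
  · rw [eq_bot_iff]
    rintro _ ⟨x, hx, rfl⟩
    have hx : (x : M) ∈ F (a - 1) m := hx
    rw [hbot _ _ (by lia), Submodule.mem_bot, Submodule.coe_eq_zero] at hx
    rw [hx, map_zero]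
    exact zero_mem _
  · rw [eq_top_iff]
    rintro y -
    obtain ⟨x, rfl⟩ := (e m).surjective y
    obtain ⟨x, rfl⟩ := Submodule.mkQ_surjective _ x
    exact ⟨x, x.2.1, rfl⟩
  · by_cases h : (ComplexShape.up' ((-r, r - 1) : ℤ × ℤ)).Rel (p, q) pq
    · have h1 : p + -r = pq.1 := congrArg Prod.fst h
      have : Subsingleton ((filteredPage F hd r).X pq) :=
        subsingleton_pageTerm_of_eq_bot (d := d) (r := r) (hbot pq.1 (pq.1 + pq.2) (by lia))
      exact ModuleCat.hom_ext (LinearMap.ext fun x => this.elim _ _)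
    · exact HomologicalComplex.shape _ _ _ h
  · by_cases h : (ComplexShape.up' ((-r, r - 1) : ℤ × ℤ)).Rel pq (p, q)
    · have h1 : pq.1 + -r = p := congrArg Prod.fst h
      have : Subsingleton ((filteredPage F hd r).X pq) :=
        subsingleton_pageTerm_of_eq_pred (d := d) (r := r) (m := pq.1 + pq.2)
          ((htop _ _ (by lia)).trans (htop _ _ (by lia)).symm)
      refine ModuleCat.hom_ext (LinearMap.ext fun x => ?_)
      rw [show x = 0 from this.elim _ _, map_zero, map_zero]
    · exact HomologicalComplex.shape _ _ _ h
  · exact stablePageTermEquiv hF hle π hπ (hbot _ _ (by lia)) (htop _ _ (by lia))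

theorem isZero_page_of_eq_bot (hd : ∀ x, d (d x) = 0)
    (hF : ∀ m, Monotone fun p => F p m) (p q : ℤ) (h : ∀ m, F p m = ⊥) :
    Limits.IsZero (((filteredSpectralSequence F hd hF).page 1 le_rfl).X (p, q)) :=
  @ModuleCat.isZero_of_subsingleton _ _ (ModuleCat.of K (PageTerm d F 1 p (p + q)))
    (subsingleton_pageTerm_of_eq_bot (h _))

theorem isZero_page_of_eq_pred (hd : ∀ x, d (d x) = 0)
    (hF : ∀ m, Monotone fun p => F p m) (p q : ℤ) (h : ∀ m, F p m = F (p - 1) m) :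
    Limits.IsZero (((filteredSpectralSequence F hd hF).page 1 le_rfl).X (p, q)) :=
  @ModuleCat.isZero_of_subsingleton _ _ (ModuleCat.of K (PageTerm d F 1 p (p + q)))
    (subsingleton_pageTerm_of_eq_pred (h _))

/-- The first page of the spectral sequence of a filtered complex, computed by a map that is
inverted, up to elements of lower filtration and homotopy, by a second one. -/
noncomputable def firstPageEquiv (hd : ∀ x, d (d x) = 0)
    (hF : ∀ m, Monotone fun p => F p m) (p q : ℤ)
    (N : Type*) [AddCommGroup N] [Module K N] (Ψ : M →ₗ[K] N) (Φ : N →ₗ[K] M)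
    (hΦ : ∀ y, Φ y ∈ F p (p + q)) (hdΦ : ∀ y, d (Φ y) ∈ F (p - 1) (p + q - 1))
    (hΨΦ : ∀ y, Ψ (Φ y) = y) (hΨ : ∀ x ∈ F (p - 1) (p + q), Ψ x = 0)
    (hΨd : ∀ x ∈ F p (p + q + 1), Ψ (d x) = 0)
    (h : ∀ x ∈ F p (p + q), d x ∈ F (p - 1) (p + q - 1) → ∃ z ∈ F p (p + q + 1),
      x - Φ (Ψ x) - d z ∈ F (p - 1) (p + q)) :
    ((filteredSpectralSequence F hd hF).page 1 le_rfl).X (p, q) ≃ₗ[K] N :=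
  quotientEquivOfSurjective _ (Ψ ∘ₗ (approxCycles d F 1 p (p + q)).subtype)
    (fun y => ⟨⟨Φ y, hΦ y, hdΦ y⟩, hΨΦ y⟩)
    (by
      rintro ⟨x, hx⟩
      change Ψ x = 0 ↔ x ∈ approxBoundaries d F 1 p (p + q)
      rw [mem_approxBoundaries]
      simp only [mem_approxCycles]
      constructor
      · intro hx0
        obtain ⟨z, hz, hz'⟩ := h x hx.1 hx.2
        rw [hx0, map_zero, sub_zero] at hz'
        refine ⟨x - d z, ⟨hz', ?_⟩, z, ⟨?_, ?_⟩, sub_add_cancel x (d z)⟩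
        · rw [map_sub, hd, sub_zero]
          simpa using hx.2
        · simpa using hz
        · have := sub_mem hx.1 (hF _ (by lia : p - 1 ≤ p) hz')
          simpa using this
      · rintro ⟨a, ha, y, hy, rfl⟩
        rw [map_add, hΨ a ha.1, hΨd y (by simpa using hy.1), add_zero])

end Convergence

/-! ### Coordinate projections of free vector spaces. -/

section Projection

variable (K : Type u) [Field K] {α : Type*}

open scoped Classical in
/-- The projection of linear combinations to those supported in `S`. -/
noncomputable def suppProj (S : Set α) : (α →₀ K) →ₗ[K] (α →₀ K) :=
  (Finsupp.supported K K S).subtype ∘ₗ Finsupp.restrictDom K K S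

variable {K}

open scoped Classical in
theorem suppProj_apply (S : Set α) (x : α →₀ K) (a : α) :
    suppProj K S x a = if a ∈ S then x a else 0 := by
  exact Finsupp.filter_apply _ _ _

theorem suppProj_mem {S T : Set α} {x : α →₀ K} (hx : x ∈ Finsupp.supported K K T) :
    suppProj K S x ∈ Finsupp.supported K K (T ∩ S) := by
  rw [Finsupp.mem_supported'] at hx ⊢
  intro a ha
  rw [suppProj_apply]
  split_ifs with h
  · exact hx a fun h' => ha ⟨h', h⟩
  · rfl

theorem sub_suppProj_mem {S T : Set α} {x : α →₀ K} (hx : x ∈ Finsupp.supported K K T) :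
    x - suppProj K S x ∈ Finsupp.supported K K (T \ S) := by
  rw [Finsupp.mem_supported'] at hx ⊢
  intro a ha
  rw [Finsupp.sub_apply, suppProj_apply]
  split_ifs with h
  · exact sub_self _
  · rw [sub_zero]
    exact hx a fun h' => ha ⟨h', h⟩

theorem suppProj_eq_self {S : Set α} {x : α →₀ K} (hx : x ∈ Finsupp.supported K K S) :
    suppProj K S x = x := by
  rw [Finsupp.mem_supported'] at hx
  ext a
  rw [suppProj_apply]
  split_ifs with h
  · rfl
  · exact (hx a h).symm

theorem suppProj_eq_zero {S T : Set α} {x : α →₀ K} (hx : x ∈ Finsupp.supported K K T)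
    (h : Disjoint T S) : suppProj K S x = 0 := by
  rw [Finsupp.mem_supported'] at hx
  ext a
  rw [suppProj_apply]
  split_ifs with h'
  · exact hx a fun ha => Set.disjoint_left.1 h ha h'
  · rfl

/-- A linear map that maps the basis vectors of `S` into a subspace maps the span into it. -/
theorem map_mem_of_supported {N : Type*} [AddCommGroup N] [Module K N] {S : Set α}
    {Q : Submodule K N} {f : (α →₀ K) →ₗ[K] N} (h : ∀ a ∈ S, f (Finsupp.single a 1) ∈ Q)
    {x : α →₀ K} (hx : x ∈ Finsupp.supported K K S) : f x ∈ Q := by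
  rw [Finsupp.supported_eq_span_single] at hx
  have hle : Submodule.span K ((fun a => Finsupp.single a (1 : K)) '' S) ≤ Q.comap f :=
    Submodule.span_le.2 (by rintro _ ⟨a, ha, rfl⟩; exact h a ha)
  exact hle hx

/-- Linear maps that agree on the basis vectors of `S` agree on their span. -/
theorem eq_of_supported {N : Type*} [AddCommGroup N] [Module K N] {S : Set α}
    {f g : (α →₀ K) →ₗ[K] N} (h : ∀ a ∈ S, f (Finsupp.single a 1) = g (Finsupp.single a 1))
    {x : α →₀ K} (hx : x ∈ Finsupp.supported K K S) : f x = g x :=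
  sub_eq_zero.1 ((Submodule.mem_bot K).1 (map_mem_of_supported (f := f - g)
    (fun a ha => (Submodule.mem_bot K).2 (sub_eq_zero.2 (h a ha))) hx))

end Projection

/-! ### Relative chains on the simplices outside X, and the connecting isomorphism. -/

section Relative

variable (K : Type u) [Field K] {V : Type v}

/-- The relative chains of the pair `(Y, X ∩ Y)`. -/
def relChains (X Y : Complex V) (i : ℤ) : Submodule K (Finset V →₀ K) :=
  Finsupp.supported K K {σ | σ ∈ Y ∧ σ ∉ X ∧ simplexDim σ = i}

variable {K} in
theorem suppProj_mem_relChains (X Y : Complex V) {i : ℤ} {x : Finset V →₀ K}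
    (hx : x ∈ chains K Y i) : suppProj K {σ | σ ∉ X} x ∈ relChains K X Y i :=
  Finsupp.supported_mono (t := {σ | σ ∈ Y ∧ σ ∉ X ∧ simplexDim σ = i})
    (fun _ h => ⟨h.1.1, h.2, h.1.2⟩) (suppProj_mem (T := {σ | σ ∈ Y ∧ simplexDim σ = i}) hx)

variable {K} in
theorem sub_suppProj_mem_chains (X Y : Complex V) {i : ℤ} {x : Finset V →₀ K}
    (hx : x ∈ chains K Y i) : x - suppProj K {σ | σ ∉ X} x ∈ chains K (X ⊓ Y) i :=
  Finsupp.supported_mono (t := {σ | σ ∈ X ⊓ Y ∧ simplexDim σ = i})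
    (fun _ h => ⟨⟨not_not.1 h.2, h.1.1⟩, h.1.2⟩)
    (sub_suppProj_mem (T := {σ | σ ∈ Y ∧ simplexDim σ = i}) hx)

variable {K} in
theorem relChains_le_chains (X Y : Complex V) (i : ℤ) : relChains K X Y i ≤ chains K Y i :=
  Finsupp.supported_mono fun _ h => ⟨h.1, h.2.2⟩

variable [LinearOrder V]

/-- The boundary of chains modulo the chains of `X`. -/
noncomputable def relBoundary (X : Complex V) : (Finset V →₀ K) →ₗ[K] (Finset V →₀ K) :=
  suppProj K {σ | σ ∉ X} ∘ₗ boundary K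

variable {K}

theorem boundary_mem_supported (X : Complex V) {x : Finset V →₀ K}
    (hx : x ∈ Finsupp.supported K K {σ | σ ∈ X}) :
    boundary K x ∈ Finsupp.supported K K {σ | σ ∈ X} := by
  rw [boundary, Finsupp.linearCombination_apply]
  exact Submodule.sum_mem _ fun σ hσ => Submodule.smul_mem _ _ <| Submodule.sum_mem _ fun v _ =>
    Finsupp.single_mem_supported K _
      (X.lower (Finset.erase_subset v σ) ((Finsupp.mem_supported K x).1 hx hσ))

theorem relBoundary_eq_zero (X : Complex V) {x : Finset V →₀ K}
    (hx : x ∈ Finsupp.supported K K {σ | σ ∈ X}) : relBoundary K X x = 0 :=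
  suppProj_eq_zero (boundary_mem_supported X hx) (Set.disjoint_left.2 fun _ h h' => h' h)

/-- X is closed under faces, so simplices of X have boundaries that are discarded anyway. This
yields both that `relBoundary` squares to zero and that the projection is a chain map. -/
theorem relBoundary_suppProj (X : Complex V) (x : Finset V →₀ K) :
    relBoundary K X (suppProj K {σ | σ ∉ X} x) = relBoundary K X x := by
  rw [← sub_eq_zero, ← map_sub, ← neg_sub, map_neg, neg_eq_zero]
  exact relBoundary_eq_zero X (Finsupp.supported_mono (fun σ h => not_not.1 h.2)
    (sub_suppProj_mem (S := {σ | σ ∉ X}) (T := Set.univ) (by simp)))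

theorem relBoundary_relBoundary (X : Complex V) (x : Finset V →₀ K) :
    relBoundary K X (relBoundary K X x) = 0 := by
  change relBoundary K X (suppProj K {σ | σ ∉ X} (boundary K x)) = 0
  rw [relBoundary_suppProj]
  change suppProj K {σ | σ ∉ X} (boundary K (boundary K x)) = 0
  rw [boundary_boundary, map_zero]

theorem relBoundary_mem_relChains (X Y : Complex V) {i j : ℤ} (hij : j + 1 = i)
    {x : Finset V →₀ K} (hx : x ∈ relChains K X Y i) : relBoundary K X x ∈ relChains K X Y j :=
  suppProj_mem_relChains X Y (boundary_mem_chains K Y hij x (relChains_le_chains X Y i hx))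

variable (K)

/-- The complex of relative chains of `(Y, X ∩ Y)`, with the simplices outside of `X` as a
basis. -/
noncomputable def relChainComplex (X Y : Complex V) : ChainComplex (ModuleCat.{max u v} K) ℤ where
  X i := ModuleCat.of K (relChains K X Y i)
  d i j :=
    if h : j + 1 = i then
      ModuleCat.ofHom ((relBoundary K X).restrict fun _ hx => relBoundary_mem_relChains X Y h hx)
    else 0
  shape i j h := dif_neg h
  d_comp_d' i j k hij hjk := by
    have hij' : j + 1 = i := hij
    have hjk' : k + 1 = j := hjk
    rw [dif_pos hij', dif_pos hjk', ← ModuleCat.ofHom_comp]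
    refine ModuleCat.hom_ext (LinearMap.ext fun c => Subtype.ext ?_)
    exact relBoundary_relBoundary X c.1

/-- The quotient map from the chains of `Y` to the chains modulo `X`. -/
noncomputable def toRelChainComplex (X Y : Complex V) :
    reducedChainComplex K Y ⟶ relChainComplex K X Y where
  f i := ModuleCat.ofHom ((suppProj K {σ | σ ∉ X}).restrict
    fun _ hx => suppProj_mem_relChains X Y hx)
  comm' i j hij := by
    have hij' : j + 1 = i := hij
    simp only [reducedChainComplex, relChainComplex, dif_pos hij', ← ModuleCat.ofHom_comp]
    congr 1
    exact LinearMap.ext fun x => Subtype.ext (relBoundary_suppProj X x.1)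

/-- This lets the abstract cokernel in `relativeChainComplex` be replaced by a complex with an
explicit basis. -/
theorem shortExact_relChainComplex (X Y : Complex V)
    (w : inclusionMap K (inf_le_right : X ⊓ Y ≤ Y) ≫ toRelChainComplex K X Y = 0) :
    (ShortComplex.mk _ _ w).ShortExact := by
  refine HomologicalComplex.shortExact_of_degreewise_shortExact _ fun i =>
    ModuleCat.shortComplex_shortExact _ ?_ ?_ ?_
  · rintro ⟨x, hx⟩
    constructor
    · intro h
      have h : suppProj K {σ | σ ∉ X} x = 0 := congrArg Subtype.val h
      have hx' := sub_suppProj_mem_chains X Y hx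
      rw [h, sub_zero] at hx'
      exact ⟨⟨x, hx'⟩, rfl⟩
    · rintro ⟨⟨y, hy⟩, hyx⟩
      have hyx : y = x := congrArg Subtype.val hyx
      subst hyx
      exact Subtype.ext (suppProj_eq_zero hy (Set.disjoint_left.2 fun _ h h' => h' h.1.1))
  · exact Submodule.inclusion_injective (chains_mono K inf_le_right i)
  · rintro ⟨x, hx⟩
    exact ⟨⟨x, relChains_le_chains X Y i hx⟩, Subtype.ext (suppProj_eq_self
      (Finsupp.supported_mono (fun _ h => h.2.1) hx))⟩

/-- The relative homology of `(Y, X ∩ Y)` in terms of the simplices outside of `X`. -/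
theorem nonempty_relativeHomology_equiv (X Y : Complex V) (i : ℤ) :
    Nonempty (SubHomology (relBoundary K X) (relChains K X Y i) (relChains K X Y (i + 1)) ≃ₗ[K]
      relativeHomology K (inf_le_right : X ⊓ Y ≤ Y) i) := by
  have w : inclusionMap K (inf_le_right : X ⊓ Y ≤ Y) ≫ toRelChainComplex K X Y = 0 := by
    ext i x
    exact Subtype.ext (suppProj_eq_zero x.2 (Set.disjoint_left.2 fun _ h h' => h' h.1.1))
  have h := shortExact_relChainComplex K X Y w
  have := h.epi_g
  let e : relativeChainComplex K (inf_le_right : X ⊓ Y ≤ Y) ≅ relChainComplex K X Y :=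
    (Limits.cokernelIsCokernel _).coconePointUniqueUpToIso h.exact.gIsCokernel
  refine ⟨(chainComplexHomologyEquiv (relChainComplex K X Y) (relBoundary K X) (relChains K X Y)
    (fun _ => LinearEquiv.refl K _) (fun i j hij x => ?_) i).trans
      (HomologicalComplex.homologyMapIso e i).symm.toLinearEquiv⟩
  have : (relChainComplex K X Y).d i j = ModuleCat.ofHom ((relBoundary K X).restrict
    fun _ hx => relBoundary_mem_relChains X Y hij hx) := dif_pos hij
  rw [this]
  rfl

/-- The reduced homology in terms of the boundary of oriented simplices. -/
theorem nonempty_reducedHomology_equiv (X : Complex V) (i : ℤ) :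
    Nonempty (SubHomology (boundary K) (chains K X i) (chains K X (i + 1)) ≃ₗ[K]
      reducedHomology K X i) := by
  refine ⟨chainComplexHomologyEquiv (reducedChainComplex K X) (boundary K) (chains K X)
    (fun _ => LinearEquiv.refl K _) (fun i j hij x => ?_) i⟩
  have : (reducedChainComplex K X).d i j =
    ModuleCat.ofHom ((boundary K).restrict (boundary_mem_chains K X hij)) := dif_pos hij
  rw [this]
  rfl

/-- The connecting isomorphism from the homology of `(Y, X ∩ Y)` to that of `X ∩ Y` if `Y` is
acyclic. -/
theorem nonempty_connecting_equiv (X Y : Complex V)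
    (hY : ∀ i, ∀ x ∈ chains K Y i, boundary K x = 0 → ∃ y ∈ chains K Y (i + 1), boundary K y = x)
    (i : ℤ) :
    Nonempty (SubHomology (relBoundary K X) (relChains K X Y i) (relChains K X Y (i + 1)) ≃ₗ[K]
      SubHomology (boundary K) (chains K (X ⊓ Y) (i - 1)) (chains K (X ⊓ Y) i)) := by
  have hbd : ∀ x ∈ cyclesIn (relBoundary K X) (relChains K X Y i),
      boundary K x ∈ cyclesIn (boundary K) (chains K (X ⊓ Y) (i - 1)) := fun x hx => by
    refine ⟨?_, boundary_boundary K x⟩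
    have h := sub_suppProj_mem_chains X Y
      (boundary_mem_chains K Y (by ring : i - 1 + 1 = i) x (relChains_le_chains X Y i hx.1))
    have hx2 : suppProj K {σ | σ ∉ X} (boundary K x) = 0 := hx.2
    rwa [hx2, sub_zero] at h
  have hX : ∀ j, ∀ x ∈ chains K (X ⊓ Y) j, suppProj K {σ | σ ∉ X} x = 0 := fun j x hx =>
    suppProj_eq_zero hx (Set.disjoint_left.2 fun _ h h' => h' h.1.1)
  have hR : ∀ j, ∀ x ∈ relChains K X Y j, suppProj K {σ | σ ∉ X} x = x := fun j x hx =>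
    suppProj_eq_self (Finsupp.supported_mono (fun _ h => h.2.1) hx)
  refine ⟨quotientEquivOfSurjective _ (Submodule.mkQ _ ∘ₗ (boundary K).restrict hbd) ?_ ?_⟩
  · intro u
    obtain ⟨⟨u, hu⟩, rfl⟩ := Submodule.mkQ_surjective _ u
    -- Fill the cycle u in the acyclic Y and discard the part of the filling in X; this changes the
    -- boundary only by a boundary in X ∩ Y.
    obtain ⟨y, hy, rfl⟩ := hY (i - 1) u (chains_mono K inf_le_right _ hu.1) hu.2
    rw [sub_add_cancel] at hy
    refine ⟨⟨suppProj K {σ | σ ∉ X} y, suppProj_mem_relChains X Y hy, ?_⟩, ?_⟩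
    · change relBoundary K X _ = 0
      rw [relBoundary_suppProj]
      exact hX _ _ hu.1
    · refine (Submodule.Quotient.eq _).2 ⟨-(y - suppProj K {σ | σ ∉ X} y),
        neg_mem (sub_suppProj_mem_chains X Y hy), ?_⟩
      change boundary K _ = boundary K _ - boundary K y
      rw [← map_sub, neg_sub]
      rfl
  · rintro ⟨z, hz⟩
    rw [LinearMap.comp_apply, Submodule.mkQ_apply, Submodule.Quotient.mk_eq_zero,
      mem_submoduleOf_iff, mem_submoduleOf_iff]
    constructor
    · rintro ⟨t, ht, htz⟩
      have htz : boundary K t = boundary K z := htz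
      -- Since z and t have the same boundary, z - t is a cycle of Y; the part outside X of a
      -- filling has relative boundary z.
      obtain ⟨y, hy, hyz⟩ := hY i (z - t)
        (sub_mem (relChains_le_chains X Y i hz.1) (chains_mono K inf_le_right _ ht))
        (by rw [map_sub, htz, sub_self])
      refine ⟨suppProj K {σ | σ ∉ X} y, suppProj_mem_relChains X Y hy, ?_⟩
      rw [relBoundary_suppProj]
      change suppProj K {σ | σ ∉ X} (boundary K y) = z
      rw [hyz, map_sub, hX i t ht, hR i z hz.1, sub_zero]
    · rintro ⟨y, hy, hyz⟩
      have hyz : relBoundary K X y = z := hyz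
      refine ⟨-(boundary K y - relBoundary K X y), neg_mem (sub_suppProj_mem_chains X Y
        (boundary_mem_chains K Y rfl y (relChains_le_chains X Y _ hy))), ?_⟩
      change boundary K _ = boundary K z
      rw [neg_sub, map_sub, boundary_boundary, sub_zero, hyz]

end Relative

/-! ### Acyclicity of the full simplex by coning. -/

section Cone

variable (K : Type u) [Field K] {V : Type v} [LinearOrder V]

/-- The sign with which the face opposite to `v` occurs in the boundary of `σ`. -/
def faceSign (σ : Finset V) (v : V) : K := (-1) ^ (σ.filter (· < v)).card

variable {K}

theorem boundary_single_one (σ : Finset V) : boundary K (Finsupp.single σ 1) =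
    ∑ v ∈ σ, Finsupp.single (σ.erase v) (faceSign K σ v) := by
  rw [boundary_single, one_smul]
  rfl

theorem faceSign_insert {σ : Finset V} {v w : V} (hw : w ∉ σ) (hwv : w < v) :
    faceSign K (insert w σ) v = -faceSign K σ v := by
  rw [faceSign, Finset.filter_insert, if_pos hwv, Finset.card_insert_of_notMem (by simp [hw]),
    pow_succ, faceSign, mul_neg_one]

theorem faceSign_of_le {σ : Finset V} {w : V} (h : ∀ v ∈ σ, w ≤ v) : faceSign K σ w = 1 := by
  rw [faceSign, Finset.filter_false_of_mem fun v hv => (h v hv).not_gt, Finset.card_empty, pow_zero]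

/-- The cone operator with apex `w`. -/
noncomputable def coneMap (K : Type u) [Field K] (w : V) : (Finset V →₀ K) →ₗ[K] (Finset V →₀ K) :=
  Finsupp.linearCombination K fun σ => if w ∈ σ then 0 else Finsupp.single (insert w σ) 1

theorem coneMap_single_of_mem {w : V} {σ : Finset V} (h : w ∈ σ) (c : K) :
    coneMap K w (Finsupp.single σ c) = 0 := by
  simp [coneMap, h]

theorem coneMap_single_of_notMem {w : V} {σ : Finset V} (h : w ∉ σ) (c : K) :
    coneMap K w (Finsupp.single σ c) = Finsupp.single (insert w σ) c := by
  simp [coneMap, h]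

/-- As w precedes all vertices of σ, the face opposite to w has sign +1, and inserting w flips every
other sign, so the remaining terms cancel. -/
theorem coneMap_homotopy {w : V} {σ : Finset V} (hw : ∀ v ∈ σ, w ≤ v) :
    boundary K (coneMap K w (Finsupp.single σ 1)) + coneMap K w (boundary K (Finsupp.single σ 1)) =
      Finsupp.single σ 1 := by
  rw [boundary_single_one, map_sum]
  by_cases h : w ∈ σ
  · rw [coneMap_single_of_mem h, map_zero, zero_add, Finset.sum_eq_single_of_mem w h]
    · rw [coneMap_single_of_notMem (Finset.notMem_erase w σ), Finset.insert_erase h,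
        faceSign_of_le hw]
    · intro v _ hvw
      exact coneMap_single_of_mem (Finset.mem_erase.2 ⟨hvw.symm, h⟩) _
  · rw [coneMap_single_of_notMem h, boundary_single_one, Finset.sum_insert h,
      Finset.erase_insert h, faceSign_of_le (by simpa using hw), add_assoc, ← Finset.sum_add_distrib,
      Finset.sum_eq_zero, add_zero]
    intro v hv
    have hvw : v ≠ w := fun e => h (e ▸ hv)
    rw [coneMap_single_of_notMem fun h' => h (Finset.mem_of_mem_erase h'),
      faceSign_insert h ((hw v hv).lt_of_ne' hvw), Finset.erase_insert_of_ne hvw.symm,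
      ← Finsupp.single_add, neg_add_cancel, Finsupp.single_zero]

/-- The full simplex on a non-empty set is acyclic. -/
theorem exists_boundary_eq_of_simplex {σ : Finset V} (hσ : σ.Nonempty) (i : ℤ)
    (x : Finset V →₀ K) (hx : x ∈ chains K (LowerSet.Iic σ) i) (hdx : boundary K x = 0) :
    ∃ y ∈ chains K (LowerSet.Iic σ) (i + 1), boundary K y = x := by
  set w := σ.min' hσ
  refine ⟨coneMap K w x, ?_, ?_⟩
  · refine map_mem_of_supported (fun τ hτ => ?_) hx
    by_cases h : w ∈ τ
    · rw [coneMap_single_of_mem h]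
      exact zero_mem _
    · rw [coneMap_single_of_notMem h]
      refine Finsupp.single_mem_supported K _ ⟨?_, ?_⟩
      · exact Finset.insert_subset (σ.min'_mem hσ) hτ.1
      · have := hτ.2
        simp only [simplexDim] at this ⊢
        rw [Finset.card_insert_of_notMem h]
        push_cast
        linarith
  · have h : boundary K (coneMap K w x) + coneMap K w (boundary K x) = x :=
      eq_of_supported (f := boundary K ∘ₗ coneMap K w + coneMap K w ∘ₗ boundary K)
        (g := LinearMap.id)
        (fun τ hτ => coneMap_homotopy fun v hv => σ.min'_le v (hτ.1 hv)) hx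
    rwa [hdx, map_zero, add_zero] at h

end Cone

/-! ### Contracting a complex of vector spaces to its homology. -/

section Contraction

variable {K : Type u} [Field K] {M : Type*} [AddCommGroup M] [Module K M]

/-- A homotopy equivalence between a graded family of subspaces `P i` of a space with differential
`d` and a family `H i` with differential zero. -/
structure Contraction (d : M →ₗ[K] M) (P : ℤ → Submodule K M) (H : ℤ → Type*)
    [∀ i, AddCommGroup (H i)] [∀ i, Module K (H i)] where
  /-- the representing cycles -/
  ι : ∀ i, H i →ₗ[K] M
  /-- the projection -/
  ρ : ∀ i, M →ₗ[K] H i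
  /-- the homotopy -/
  h : M →ₗ[K] M
  ι_mem : ∀ i y, ι i y ∈ P i
  d_ι : ∀ i y, d (ι i y) = 0
  ρ_d : ∀ i, ∀ x ∈ P (i + 1), ρ i (d x) = 0
  ρ_ι : ∀ i y, ρ i (ι i y) = y
  ρ_ne : ∀ i j, i ≠ j → ∀ x ∈ P j, ρ i x = 0
  h_mem : ∀ i, ∀ x ∈ P i, h x ∈ P (i + 1)
  homotopy : ∀ i, ∀ x ∈ P i, x - ι i (ρ i x) = d (h x) + h (d x)

/-- Over a field, d restricted to Q splits over its image, and the splitting extends linearly to all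
of M. -/
theorem exists_section_of_boundaries (d : M →ₗ[K] M) (Q : Submodule K M) :
    ∃ t : M →ₗ[K] M, ∀ y ∈ Q, t (d y) ∈ Q ∧ d (t (d y)) = d y := by
  let f := (d ∘ₗ Q.subtype).rangeRestrict
  obtain ⟨s, hs⟩ := f.exists_rightInverse_of_surjective (LinearMap.range_rangeRestrict _)
  obtain ⟨t, ht⟩ := LinearMap.exists_extend (Q.subtype ∘ₗ s)
  have key : ∀ z, t (f z : M) = s (f z) := fun z => LinearMap.congr_fun ht (f z)
  refine ⟨t, fun y hy => ?_⟩
  have h1 : t (d y) = s (f ⟨y, hy⟩) := key ⟨y, hy⟩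
  rw [h1]
  exact ⟨(s (f ⟨y, hy⟩)).2, congrArg Subtype.val (LinearMap.congr_fun hs (f ⟨y, hy⟩))⟩

/-- Over a field, the map from cycles to homology splits (giving ι) and extends from the cycles to
the whole space (giving α). -/
theorem exists_representatives (d : M →ₗ[K] M) (P Q : Submodule K M) {H : Type*} [AddCommGroup H]
    [Module K H] (e : SubHomology d P Q ≃ₗ[K] H) :
    ∃ (ι : H →ₗ[K] M) (α : M →ₗ[K] H), (∀ y, ι y ∈ cyclesIn d P) ∧ (∀ y, α (ι y) = y) ∧
      ∀ x ∈ cyclesIn d P, α x = 0 ↔ x ∈ Q.map d := by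
  let f : cyclesIn d P →ₗ[K] H := e.toLinearMap ∘ₗ Submodule.mkQ _
  obtain ⟨s, hs⟩ := f.exists_rightInverse_of_surjective
    (LinearMap.range_eq_top.2 (e.surjective.comp (Submodule.mkQ_surjective _)))
  obtain ⟨α, hα⟩ := LinearMap.exists_extend f
  have key : ∀ z : cyclesIn d P, α z = f z := fun z => LinearMap.congr_fun hα z
  refine ⟨(cyclesIn d P).subtype ∘ₗ s, α, fun y => (s y).2, fun y => ?_, fun x hx => ?_⟩
  · exact (key (s y)).trans (LinearMap.congr_fun hs y)
  · rw [key ⟨x, hx⟩, LinearMap.comp_apply, LinearEquiv.coe_coe, e.map_eq_zero_iff,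
      Submodule.mkQ_apply, Submodule.Quotient.mk_eq_zero, mem_submoduleOf_iff]

/-- Over a field, a complex with a homogeneous basis contracts to its homology. -/
theorem nonempty_contraction {α : Type*} (d : (α →₀ K) →ₗ[K] (α →₀ K)) (hd : ∀ x, d (d x) = 0)
    (P : ℤ → Submodule K (α →₀ K)) (T : ℤ → Set α) (hP : ∀ i, P i = Finsupp.supported K K (T i))
    (deg : α → ℤ) (hT : ∀ i, ∀ a ∈ T i, deg a = i) (hdP : ∀ i, ∀ x ∈ P (i + 1), d x ∈ P i)
    (H : ℤ → Type*) [∀ i, AddCommGroup (H i)] [∀ i, Module K (H i)]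
    (e : ∀ i, SubHomology d (P i) (P (i + 1)) ≃ₗ[K] H i) : Nonempty (Contraction d P H) := by
  choose t ht using fun i => exists_section_of_boundaries d (P i)
  choose ι r hι hrι hr using fun i => exists_representatives d (P i) (P (i + 1)) (e i)
  let c : ∀ i, (α →₀ K) →ₗ[K] (α →₀ K) := fun i => LinearMap.id - t i ∘ₗ d
  have hc : ∀ i, ∀ x ∈ P i, c i x ∈ cyclesIn d (P i) := fun i x hx =>
    ⟨sub_mem hx (ht i x hx).1, by
      change d (x - t i (d x)) = 0
      rw [map_sub, (ht i x hx).2, sub_self]⟩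
  have hc' : ∀ i x, d x = 0 → c i x = x := fun i x hx => by
    change x - t i (d x) = x
    rw [hx, map_zero, sub_zero]
  -- Projecting to degree i beforehand makes `ρ i` vanish in all other degrees, as `ρ_ne` demands.
  let ρ : ∀ i, (α →₀ K) →ₗ[K] H i := fun i => r i ∘ₗ c i ∘ₗ suppProj K (T i)
  have hρ : ∀ i, ∀ x ∈ P i, ρ i x = r i (c i x) := fun i x hx => by
    rw [hP] at hx
    exact congrArg (fun z => r i (c i z)) (suppProj_eq_self hx)
  have hρd : ∀ i, ∀ x ∈ P (i + 1), ρ i (d x) = 0 := fun i x hx => by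
    rw [hρ i _ (hdP i x hx), hc' i _ (hd x), hr i _ ⟨hdP i x hx, hd x⟩]
    exact ⟨x, hx, rfl⟩
  -- On P i the chain c x - ι ρ x is a cycle of class zero, so t lifts it through d. The homogeneous
  -- basis lets these degreewise maps be glued into a single h.
  let hh : ∀ i, (α →₀ K) →ₗ[K] (α →₀ K) := fun i => t (i + 1) ∘ₗ (c i - ι i ∘ₗ ρ i)
  let h : (α →₀ K) →ₗ[K] (α →₀ K) :=
    Finsupp.linearCombination K fun a => hh (deg a) (Finsupp.single a 1)
  have hhh : ∀ i, ∀ x ∈ P i, h x = t (i + 1) (c i x - ι i (ρ i x)) := fun i x hx => by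
    rw [hP] at hx
    refine eq_of_supported (f := h) (g := hh i) (fun a ha => ?_) hx
    change Finsupp.linearCombination K _ _ = _
    rw [Finsupp.linearCombination_single, one_smul, hT i a ha]
  have hcρ : ∀ i, ∀ x ∈ P i, ∃ y ∈ P (i + 1), d y = c i x - ι i (ρ i x) := fun i x hx => by
    have hmem := sub_mem (hc i x hx) (hι i (ρ i x))
    obtain ⟨y, hy, hyx⟩ := (hr i _ hmem).1 (by rw [map_sub, hrι, hρ i x hx, sub_self])
    exact ⟨y, hy, hyx⟩
  refine ⟨⟨ι, ρ, h, fun i y => (hι i y).1, fun i y => (hι i y).2, hρd, fun i y => ?_,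
    fun i j hij x hx => ?_, fun i x hx => ?_, fun i x hx => ?_⟩⟩
  · rw [hρ i _ (hι i y).1, hc' i _ (hι i y).2, hrι]
  · rw [hP] at hx
    change r i (c i (suppProj K (T i) x)) = 0
    rw [suppProj_eq_zero hx, map_zero, map_zero]
    exact Set.disjoint_left.2 fun a h1 h2 => hij ((hT i a h2).symm.trans (hT j a h1))
  · obtain ⟨y, hy, hyx⟩ := hcρ i x hx
    rw [hhh i x hx, ← hyx]
    exact (ht (i + 1) y hy).1
  · obtain ⟨y, hy, hyx⟩ := hcρ i x hx
    obtain ⟨j, rfl⟩ : ∃ j, i = j + 1 := ⟨i - 1, by ring⟩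
    -- Here d h x = c x - ι ρ x, while dx is a cycle of class zero, so h d x = t d x = x - c x.
    rw [hhh _ x hx, hhh j _ (hdP j x hx), hρd j x hx, map_zero, sub_zero, hc' j _ (hd x), ← hyx,
      (ht _ y hy).2, hyx]
    change _ = x - t (j + 1) (d x) - _ + _
    abel

end Contraction

/-! ### The Künneth theorem for contractions. -/

section Tensor

open scoped TensorProduct DirectSum

variable {K : Type u} [Field K] {M N : Type*} [AddCommGroup M] [Module K M] [AddCommGroup N]
  [Module K N]

/-- The part of degree `m` of the tensor product of two graded families of subspaces. -/
def tensorGrading (P : ℤ → Submodule K M) (Q : ℤ → Submodule K N) (m : ℤ) :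
    Submodule K (M ⊗[K] N) :=
  Submodule.span K {t | ∃ i j : ℤ, i + j = m ∧ ∃ x ∈ P i, ∃ y ∈ Q j, x ⊗ₜ[K] y = t}

theorem tmul_mem_tensorGrading {P : ℤ → Submodule K M} {Q : ℤ → Submodule K N} {i j m : ℤ}
    (hij : i + j = m) {x : M} (hx : x ∈ P i) {y : N} (hy : y ∈ Q j) :
    x ⊗ₜ[K] y ∈ tensorGrading P Q m :=
  Submodule.subset_span ⟨i, j, hij, x, hx, y, hy, rfl⟩

theorem map_mem_of_tensorGrading {P : ℤ → Submodule K M} {Q : ℤ → Submodule K N} {m : ℤ}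
    {L : Type*} [AddCommGroup L] [Module K L] {R : Submodule K L} {f : M ⊗[K] N →ₗ[K] L}
    (h : ∀ i j, i + j = m → ∀ x ∈ P i, ∀ y ∈ Q j, f (x ⊗ₜ y) ∈ R) {t : M ⊗[K] N}
    (ht : t ∈ tensorGrading P Q m) : f t ∈ R := by
  have hle : tensorGrading P Q m ≤ R.comap f := Submodule.span_le.2 (by
    rintro _ ⟨i, j, hij, x, hx, y, hy, rfl⟩
    exact h i j hij x hx y hy)
  exact hle ht

theorem eq_of_tensorGrading {P : ℤ → Submodule K M} {Q : ℤ → Submodule K N} {m : ℤ}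
    {L : Type*} [AddCommGroup L] [Module K L] {f g : M ⊗[K] N →ₗ[K] L}
    (h : ∀ i j, i + j = m → ∀ x ∈ P i, ∀ y ∈ Q j, f (x ⊗ₜ y) = g (x ⊗ₜ y)) {t : M ⊗[K] N}
    (ht : t ∈ tensorGrading P Q m) : f t = g t :=
  sub_eq_zero.1 ((Submodule.mem_bot K).1 (map_mem_of_tensorGrading (f := f - g)
    (fun i j hij x hx y hy => (Submodule.mem_bot K).2 (sub_eq_zero.2 (h i j hij x hx y hy))) ht))

/-- The part of degree `m` of the tensor product of two families indexed by `ℕ`. -/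
abbrev tensorSum (K : Type u) [Field K] (H H' : ℤ → Type*) [∀ i, AddCommGroup (H i)]
    [∀ i, Module K (H i)] [∀ i, AddCommGroup (H' i)] [∀ i, Module K (H' i)] (m : ℤ) :=
  ⨁ ij : {ij : ℕ × ℕ // (ij.1 : ℤ) + (ij.2 : ℤ) = m}, H ij.1.1 ⊗[K] H' ij.1.2

instance finite_natPairs (m : ℤ) : Finite {ij : ℕ × ℕ // (ij.1 : ℤ) + (ij.2 : ℤ) = m} :=
  Finite.of_injective (fun ij => (⟨ij.1, by
    rw [Finset.HasAntidiagonal.mem_antidiagonal]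
    have := ij.2
    omega⟩ : Finset.HasAntidiagonal.antidiagonal m.toNat)) fun ij ij' h => Subtype.ext (congrArg
      (fun z : Finset.HasAntidiagonal.antidiagonal m.toNat => (z : ℕ × ℕ)) h)

/-- The inclusion of a summand of `tensorSum`. -/
noncomputable def tensorLof (K : Type u) [Field K] (H H' : ℤ → Type*) [∀ i, AddCommGroup (H i)]
    [∀ i, Module K (H i)] [∀ i, AddCommGroup (H' i)] [∀ i, Module K (H' i)] {m : ℤ}
    (ij : {ij : ℕ × ℕ // (ij.1 : ℤ) + (ij.2 : ℤ) = m}) :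
    H ij.1.1 ⊗[K] H' ij.1.2 →ₗ[K] tensorSum K H H' m :=
  DirectSum.lof K {ij : ℕ × ℕ // (ij.1 : ℤ) + (ij.2 : ℤ) = m}
    (fun ij => H ij.1.1 ⊗[K] H' ij.1.2) ij

namespace Contraction

variable {d : M →ₗ[K] M} {P : ℤ → Submodule K M} {d' : N →ₗ[K] N} {Q : ℤ → Submodule K N}
  {H H' : ℤ → Type*} [∀ i, AddCommGroup (H i)] [∀ i, Module K (H i)] [∀ i, AddCommGroup (H' i)]
  [∀ i, Module K (H' i)]

/-- The projection of the tensor product onto its harmonic part. -/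
noncomputable def tensorProj (c : Contraction d P H) (c' : Contraction d' Q H') (m : ℤ) :
    M ⊗[K] N →ₗ[K] tensorSum K H H' m :=
  letI := Fintype.ofFinite {ij : ℕ × ℕ // (ij.1 : ℤ) + (ij.2 : ℤ) = m}
  ∑ ij : {ij : ℕ × ℕ // (ij.1 : ℤ) + (ij.2 : ℤ) = m},
    tensorLof K H H' ij ∘ₗ TensorProduct.map (c.ρ ij.1.1) (c'.ρ ij.1.2)

theorem tensorProj_tmul (c : Contraction d P H) (c' : Contraction d' Q H') {m : ℤ}
    (ij : {ij : ℕ × ℕ // (ij.1 : ℤ) + (ij.2 : ℤ) = m}) {x : M} {y : N} (hx : x ∈ P ij.1.1) :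
    tensorProj c c' m (x ⊗ₜ y) = tensorLof K H H' ij (c.ρ ij.1.1 x ⊗ₜ c'.ρ ij.1.2 y) := by
  rw [tensorProj, LinearMap.sum_apply]
  refine (Finset.sum_eq_single_of_mem ij (@Finset.mem_univ _ (Fintype.ofFinite _) _) fun kl _ hkl => ?_).trans ?_
  · have hne : (kl.1.1 : ℤ) ≠ ij.1.1 := fun h => hkl (Subtype.ext (Prod.ext (by exact_mod_cast h)
      (by have := kl.2; have := ij.2; omega)))
    rw [LinearMap.comp_apply, TensorProduct.map_tmul, c.ρ_ne _ _ hne x hx, TensorProduct.zero_tmul,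
      map_zero]
  · rfl

theorem tensorProj_eq_zero (c : Contraction d P H) (c' : Contraction d' Q H') {m i j : ℤ}
    {x : M} {y : N} (hx : x ∈ P i) (hy : y ∈ Q j)
    (h : i + j = m → c.ρ i x ⊗ₜ[K] c'.ρ j y = 0) : tensorProj c c' m (x ⊗ₜ y) = 0 := by
  rw [tensorProj, LinearMap.sum_apply]
  refine Finset.sum_eq_zero fun kl _ => ?_
  rw [LinearMap.comp_apply, TensorProduct.map_tmul]
  by_cases hi : (kl.1.1 : ℤ) = i
  · by_cases hj : (kl.1.2 : ℤ) = j
    · subst hi hj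
      rw [h kl.2, map_zero]
    · rw [c'.ρ_ne _ _ hj y hy, TensorProduct.tmul_zero, map_zero]
  · rw [c.ρ_ne _ _ hi x hx, TensorProduct.zero_tmul, map_zero]

/-- The inclusion of the harmonic part of the tensor product. -/
noncomputable def tensorIncl (c : Contraction d P H) (c' : Contraction d' Q H') (m : ℤ) :
    tensorSum K H H' m →ₗ[K] M ⊗[K] N :=
  DirectSum.toModule K _ _ fun ij => TensorProduct.map (c.ι ij.1.1) (c'.ι ij.1.2)

theorem tensorIncl_lof (c : Contraction d P H) (c' : Contraction d' Q H') (m : ℤ)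
    (ij : {ij : ℕ × ℕ // (ij.1 : ℤ) + (ij.2 : ℤ) = m}) (t : H ij.1.1 ⊗[K] H' ij.1.2) :
    tensorIncl c c' m (tensorLof K H H' ij t) =
      TensorProduct.map (c.ι ij.1.1) (c'.ι ij.1.2) t :=
  DirectSum.toModule_lof (M := fun ij : {ij : ℕ × ℕ // (ij.1 : ℤ) + (ij.2 : ℤ) = m} =>
    H ij.1.1 ⊗[K] H' ij.1.2) K ij t

theorem tensorSum_induction {m : ℤ} {L : Type*} [AddCommGroup L] [Module K L] {R : Submodule K L}
    (f : tensorSum K H H' m →ₗ[K] L)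
    (h : ∀ (ij : {ij : ℕ × ℕ // (ij.1 : ℤ) + (ij.2 : ℤ) = m}) (x : H ij.1.1) (y : H' ij.1.2),
      f (tensorLof K H H' ij (x ⊗ₜ y)) ∈ R) (t : tensorSum K H H' m) : f t ∈ R := by
  induction t using DirectSum.induction_on with
  | zero => rw [map_zero]; exact zero_mem _
  | of ij t =>
    induction t using TensorProduct.induction_on with
    | zero => rw [map_zero, map_zero]; exact zero_mem _
    | tmul x y => exact h ij x y
    | add s t hs ht => rw [map_add, map_add]; exact add_mem hs ht
  | add s t hs ht => rw [map_add]; exact add_mem hs ht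

/-- The differential of a tensor product. -/
noncomputable def _root_.SimplicialHomology.tensorDifferential (d ε : M →ₗ[K] M)
    (d' : N →ₗ[K] N) : M ⊗[K] N →ₗ[K] M ⊗[K] N :=
  TensorProduct.map d LinearMap.id + TensorProduct.map ε d'

/-- The homotopy of a tensor product. -/
noncomputable def tensorHomotopy (c : Contraction d P H) (c' : Contraction d' Q H')
    (ε : M →ₗ[K] M) : M ⊗[K] N →ₗ[K] M ⊗[K] N :=
  TensorProduct.map c.h LinearMap.id +
    TensorProduct.map (ε ∘ₗ (LinearMap.id - d ∘ₗ c.h - c.h ∘ₗ d)) c'.h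

/-- The projector ι ρ depends on the degree; the expression 1 - dh - hd realises it in all degrees
at once, which `tensorHomotopy` needs. -/
theorem harmonic_apply (c : Contraction d P H) {i : ℤ} {x : M} (hx : x ∈ P i) :
    (LinearMap.id - d ∘ₗ c.h - c.h ∘ₗ d : M →ₗ[K] M) x = c.ι i (c.ρ i x) := by
  have := c.homotopy i x hx
  rw [sub_eq_iff_eq_add] at this
  simp only [LinearMap.sub_apply, LinearMap.id_apply, LinearMap.comp_apply]
  nth_rewrite 1 [this]
  abel

/-- The Künneth theorem: the tensor product of contractions. -/
noncomputable def tensor (c : Contraction d P H) (c' : Contraction d' Q H') (ε : M →ₗ[K] M)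
    (s : ℤ → K) (hs : ∀ i, s (i + 1) = -s i) (hs' : ∀ i, s i * s i = 1)
    (hε : ∀ i, ∀ x ∈ P i, ε x = s i • x) (hP : ∀ i < 0, P i = ⊥) (hQ : ∀ i < 0, Q i = ⊥)
    (hdP : ∀ i, ∀ x ∈ P (i + 1), d x ∈ P i) (hdQ : ∀ i, ∀ x ∈ Q (i + 1), d' x ∈ Q i) :
    Contraction (tensorDifferential d ε d') (tensorGrading P Q) (tensorSum K H H') where
  ι m := tensorIncl c c' m
  ρ m := tensorProj c c' m
  h := tensorHomotopy c c' ε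
  ι_mem m t := tensorSum_induction _ (fun ij x y => by
    rw [tensorIncl_lof, TensorProduct.map_tmul]
    exact tmul_mem_tensorGrading ij.2 (c.ι_mem _ _) (c'.ι_mem _ _)) t
  d_ι m t := (Submodule.mem_bot K).1 (tensorSum_induction
    (tensorDifferential d ε d' ∘ₗ tensorIncl c c' m) (fun ij x y => by
    rw [Submodule.mem_bot, LinearMap.comp_apply, tensorIncl_lof, TensorProduct.map_tmul,
      tensorDifferential, LinearMap.add_apply, TensorProduct.map_tmul, TensorProduct.map_tmul,
      c.d_ι, c'.d_ι, TensorProduct.zero_tmul, TensorProduct.tmul_zero, add_zero]) t)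
  ρ_d m t ht := (Submodule.mem_bot K).1 (map_mem_of_tensorGrading
    (f := tensorProj c c' m ∘ₗ tensorDifferential d ε d') (fun i j hij x hx y hy => by
      rw [Submodule.mem_bot, LinearMap.comp_apply, tensorDifferential, LinearMap.add_apply,
        TensorProduct.map_tmul, TensorProduct.map_tmul, LinearMap.id_apply, map_add,
        hε i x hx]
      obtain ⟨i, rfl⟩ : ∃ k, i = k + 1 := ⟨i - 1, by ring⟩
      obtain ⟨j, rfl⟩ : ∃ k, j = k + 1 := ⟨j - 1, by ring⟩
      rw [tensorProj_eq_zero c c' (hdP i x hx) hy fun _ => by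
          rw [c.ρ_d i x hx, TensorProduct.zero_tmul],
        tensorProj_eq_zero c c' ((P (i + 1)).smul_mem _ hx) (hdQ j y hy) fun _ => by
          rw [c'.ρ_d j y hy, TensorProduct.tmul_zero], add_zero]) ht)
  ρ_ι m t := sub_eq_zero.1 ((Submodule.mem_bot K).1 (tensorSum_induction
    (tensorProj c c' m ∘ₗ tensorIncl c c' m - LinearMap.id) (fun ij x y => by
      rw [Submodule.mem_bot, LinearMap.sub_apply, LinearMap.comp_apply, tensorIncl_lof,
        TensorProduct.map_tmul, tensorProj_tmul c c' ij (c.ι_mem _ _), c.ρ_ι, c'.ρ_ι,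
        LinearMap.id_apply, sub_self]) t))
  ρ_ne m m' hm t ht := (Submodule.mem_bot K).1 (map_mem_of_tensorGrading
    (f := tensorProj c c' m) (fun i j hij x hx y hy => by
      rw [Submodule.mem_bot]
      exact tensorProj_eq_zero c c' hx hy fun h => absurd (h.symm.trans hij) hm) ht)
  h_mem m t ht := map_mem_of_tensorGrading (fun i j hij x hx y hy => by
    rw [tensorHomotopy, LinearMap.add_apply, TensorProduct.map_tmul, TensorProduct.map_tmul,
      LinearMap.id_apply]
    refine add_mem (tmul_mem_tensorGrading (by lia) (c.h_mem i x hx) hy)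
      (tmul_mem_tensorGrading (i := i) (by lia) ?_ (c'.h_mem j y hy))
    rw [LinearMap.comp_apply, c.harmonic_apply hx, hε i _ (c.ι_mem _ _)]
    exact (P i).smul_mem _ (c.ι_mem _ _)) ht
  homotopy m t ht := eq_of_tensorGrading
    (f := LinearMap.id - tensorIncl c c' m ∘ₗ tensorProj c c' m)
    (g := tensorDifferential d ε d' ∘ₗ tensorHomotopy c c' ε +
      tensorHomotopy c c' ε ∘ₗ tensorDifferential d ε d') (fun i j hij x hx y hy => by
    -- The sum runs over pairs of natural numbers only; nothing is lost, since P and Q vanish in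
    -- negative degrees.
    have h1 : tensorIncl c c' m (tensorProj c c' m (x ⊗ₜ y)) =
        c.ι i (c.ρ i x) ⊗ₜ c'.ι j (c'.ρ j y) := by
      rcases lt_or_ge i 0 with hi | hi
      · rw [hP i hi, Submodule.mem_bot] at hx
        simp [hx]
      · rcases lt_or_ge j 0 with hj | hj
        · rw [hQ j hj, Submodule.mem_bot] at hy
          simp [hy]
        · lift i to ℕ using hi
          lift j to ℕ using hj
          rw [tensorProj_tmul c c' ⟨(i, j), hij⟩ hx, tensorIncl_lof, TensorProduct.map_tmul]
    have h2 := c.homotopy i x hx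
    have h3 := c'.homotopy j y hy
    have hdh : d (c.ι i (c.ρ i x)) = 0 := c.d_ι _ _
    have hdx : d x ∈ P (i - 1) := hdP (i - 1) x (by rwa [sub_add_cancel])
    have hρd : c.ρ (i - 1) (d x) = 0 := c.ρ_d _ x (by rwa [sub_add_cancel])
    have hsi : s (i - 1) = -s i := by
      have := hs (i - 1)
      rw [sub_add_cancel] at this
      rw [this, neg_neg]
    simp only [LinearMap.sub_apply, LinearMap.id_apply, LinearMap.comp_apply, LinearMap.add_apply]
    rw [h1]
    simp only [tensorDifferential, tensorHomotopy, LinearMap.add_apply, TensorProduct.map_tmul,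
      map_add, LinearMap.id_apply]
    rw [LinearMap.comp_apply, LinearMap.comp_apply, LinearMap.comp_apply, c.harmonic_apply hx, c.harmonic_apply hdx,
      hρd, map_zero, map_zero, TensorProduct.zero_tmul, hε i x hx, map_smul, map_smul,
      c.harmonic_apply hx, map_smul, hε i _ (c.ι_mem _ _), map_smul, map_smul, hdh, smul_zero,
      TensorProduct.zero_tmul, hε _ _ (c.h_mem i x hx), hs, hε i _ (c.ι_mem _ _), smul_smul, hs',
      one_smul, neg_smul]
    -- Each summand is handled by the homotopy of one factor. The mixed terms h x ⊗ d' y have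
    -- cancelled, because s changes sign between consecutive degrees.
    have hsplit : x ⊗ₜ[K] y - c.ι i (c.ρ i x) ⊗ₜ[K] c'.ι j (c'.ρ j y) =
        (x - c.ι i (c.ρ i x)) ⊗ₜ[K] y + c.ι i (c.ρ i x) ⊗ₜ[K] (y - c'.ι j (c'.ρ j y)) := by
      rw [TensorProduct.sub_tmul, TensorProduct.tmul_sub]
      abel
    rw [hsplit, h2, h3, TensorProduct.add_tmul, TensorProduct.tmul_add, TensorProduct.neg_tmul]
    abel) ht

end Contraction

end Tensor

/-! ### The tensor differential squares to zero. -/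

section TensorDifferential

open scoped TensorProduct

variable {K : Type u} [Field K] {M N : Type*} [AddCommGroup M] [Module K M] [AddCommGroup N]
  [Module K N]

theorem tensorDifferential_tmul (d ε : M →ₗ[K] M) (d' : N →ₗ[K] N) (x : M) (y : N) :
    tensorDifferential d ε d' (x ⊗ₜ y) = d x ⊗ₜ y + ε x ⊗ₜ d' y := rfl

/-- The two mixed terms cancel because ε anticommutes with d. -/
theorem tensorDifferential_sq {d ε : M →ₗ[K] M} {d' : N →ₗ[K] N} (hd : ∀ x, d (d x) = 0)
    (hd' : ∀ y, d' (d' y) = 0) (hε : ∀ x, d (ε x) = -ε (d x)) (t : M ⊗[K] N) :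
    tensorDifferential d ε d' (tensorDifferential d ε d' t) = 0 := by
  induction t using TensorProduct.induction_on with
  | zero => rw [map_zero, map_zero]
  | add s t hs ht => rw [map_add, map_add, hs, ht, add_zero]
  | tmul x y =>
    rw [tensorDifferential_tmul, map_add, tensorDifferential_tmul, tensorDifferential_tmul, hd,
      hd', hε, TensorProduct.zero_tmul, TensorProduct.tmul_zero, TensorProduct.neg_tmul]
    abel

end TensorDifferential

/-! ### Surjective chain maps with acyclic kernel. -/

section SurjectiveQuasiIso

variable {K : Type u} [Field K] {M N : Type*} [AddCommGroup M] [Module K M] [AddCommGroup N]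
  [Module K N]

/-- A surjective chain map with acyclic kernel is an isomorphism on homology. -/
theorem nonempty_subHomology_equiv {d : M →ₗ[K] M} {d' : N →ₗ[K] N} (hd : ∀ x, d (d x) = 0)
    (P : ℤ → Submodule K M) (Q : ℤ → Submodule K N) (hdP : ∀ i, ∀ x ∈ P (i + 1), d x ∈ P i)
    (f : M →ₗ[K] N) (g : N →ₗ[K] M) (hf : ∀ i, ∀ x ∈ P i, f x ∈ Q i)
    (hg : ∀ i, ∀ y ∈ Q i, g y ∈ P i) (hfg : ∀ i, ∀ y ∈ Q i, f (g y) = y)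
    (hfd : ∀ i, ∀ x ∈ P i, f (d x) = d' (f x))
    (hker : ∀ i, ∀ x ∈ P i, d x = 0 → f x = 0 → ∃ z ∈ P (i + 1), d z = x ∧ f z = 0) (i : ℤ) :
    Nonempty (SubHomology d (P i) (P (i + 1)) ≃ₗ[K] SubHomology d' (Q i) (Q (i + 1))) := by
  have hcyc : ∀ x ∈ cyclesIn d (P i), f x ∈ cyclesIn d' (Q i) := fun x hx => by
    refine ⟨hf i x hx.1, ?_⟩
    rw [SetLike.mem_coe, LinearMap.mem_ker, ← hfd i x hx.1, hx.2, map_zero]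
  refine ⟨quotientEquivOfSurjective _ (Submodule.mkQ _ ∘ₗ f.restrict hcyc) ?_ ?_⟩
  · intro y
    obtain ⟨⟨y, hy⟩, rfl⟩ := Submodule.mkQ_surjective _ y
    obtain ⟨j, rfl⟩ : ∃ j, i = j + 1 := ⟨i - 1, by ring⟩
    have hgy := hg _ y hy.1
    -- The section g need not commute with the differentials, so g y need not be a cycle. Its
    -- boundary is a cycle in the kernel of f, and a bounding chain z in that kernel corrects it.
    obtain ⟨z, hz, hz1, hz2⟩ := hker j (d (g y)) (hdP j _ hgy) (hd _)
      (by rw [hfd _ _ hgy, hfg _ y hy.1]; exact hy.2)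
    refine ⟨⟨g y - z, sub_mem hgy hz, ?_⟩, congrArg (Submodule.mkQ _) (Subtype.ext ?_)⟩
    · rw [SetLike.mem_coe, LinearMap.mem_ker, map_sub, hz1, sub_self]
    · change f (g y - z) = y
      rw [map_sub, hz2, sub_zero, hfg _ y hy.1]
  · rintro ⟨x, hx⟩
    rw [LinearMap.comp_apply, Submodule.mkQ_apply, Submodule.Quotient.mk_eq_zero,
      mem_submoduleOf_iff, mem_submoduleOf_iff]
    constructor
    · rintro ⟨y, hy, hyx⟩
      have hyx : d' y = f x := hyx
      have hgy := hg _ y hy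
      obtain ⟨z, hz, hz1, -⟩ := hker i (x - d (g y)) (sub_mem hx.1 (hdP i _ hgy))
        (by rw [map_sub, hd, sub_zero]; exact hx.2)
        (by rw [map_sub, hfd _ _ hgy, hfg _ y hy, hyx, sub_self])
      exact ⟨g y + z, add_mem hgy hz, by rw [map_add, hz1, add_sub_cancel]⟩
    · rintro ⟨z, hz, hzx⟩
      exact ⟨f z, hf _ z hz, (hfd _ z hz).symm.trans (congrArg f hzx)⟩

end SurjectiveQuasiIso

/-! ### The complex of cubes [σ, σ ∪ B]. -/

section CubeComplex

variable (K : Type u) [Field K] {V : Type v} [LinearOrder V]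

/-- The part of the boundary of the cube `[σ, σ ∪ B]` that consists of the faces with a smaller
top. -/
noncomputable def cubeLower : (Finset V × Finset V →₀ K) →ₗ[K] (Finset V × Finset V →₀ K) :=
  Finsupp.linearCombination K fun c =>
    ∑ v ∈ c.2, Finsupp.single (c.1, c.2.erase v) (faceSign K c.2 v)

/-- The part of the boundary of the cube `[σ, σ ∪ B]` that consists of the faces with a larger
bottom. -/
noncomputable def cubeUpper : (Finset V × Finset V →₀ K) →ₗ[K] (Finset V × Finset V →₀ K) :=
  Finsupp.linearCombination K fun c =>
    ∑ v ∈ c.2, Finsupp.single (insert v c.1, c.2.erase v) (faceSign K c.2 v)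

/-- The boundary of cubes. -/
noncomputable def cubeBoundary : (Finset V × Finset V →₀ K) →ₗ[K] (Finset V × Finset V →₀ K) :=
  cubeLower K - cubeUpper K

variable {K}

theorem cubeLower_single (σ B : Finset V) : cubeLower K (Finsupp.single (σ, B) 1) =
    ∑ v ∈ B, Finsupp.single (σ, B.erase v) (faceSign K B v) := by
  simp [cubeLower]

theorem cubeUpper_single (σ B : Finset V) : cubeUpper K (Finsupp.single (σ, B) 1) =
    ∑ v ∈ B, Finsupp.single (insert v σ, B.erase v) (faceSign K B v) := by
  simp [cubeUpper]

theorem faceSign_swap (σ : Finset V) {v w : V} (hv : v ∈ σ) (hw : w ∈ σ) (hvw : v ≠ w) :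
    faceSign K σ v * faceSign K (σ.erase v) w + faceSign K σ w * faceSign K (σ.erase w) v = 0 := by
  rcases lt_or_gt_of_ne hvw with h | h
  · exact sign_swap K σ hv h
  · rw [add_comm]
    exact sign_swap K σ hw h

/-- Cancellation of the terms of an iterated boundary in pairs. -/
theorem sum_sum_erase_eq_zero {L : Type*} [AddCommGroup L] [Module K L] (B : Finset V)
    (g : V → V → L) (hg : ∀ v w, g v w = g w v) :
    ∑ v ∈ B, ∑ w ∈ B.erase v, (faceSign K B v * faceSign K (B.erase v) w) • g v w = 0 := by
  rw [Finset.sum_sigma']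
  refine Finset.sum_involution (fun p _ => ⟨p.2, p.1⟩) ?_ ?_ ?_ ?_
  · rintro ⟨v, w⟩ hp
    obtain ⟨hv, hw⟩ := Finset.mem_sigma.mp hp
    obtain ⟨hne, hw⟩ := Finset.mem_erase.mp hw
    dsimp only at hv hw hne ⊢
    rw [hg w v, ← add_smul, faceSign_swap B hv hw hne.symm, zero_smul]
  · rintro ⟨v, w⟩ hp _ heq
    obtain ⟨_, hw⟩ := Finset.mem_sigma.mp hp
    exact (Finset.mem_erase.mp hw).1 (congrArg Sigma.fst heq)
  · rintro ⟨v, w⟩ hp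
    obtain ⟨hv, hw⟩ := Finset.mem_sigma.mp hp
    obtain ⟨hne, hw⟩ := Finset.mem_erase.mp hw
    exact Finset.mem_sigma.mpr ⟨hw, Finset.mem_erase.mpr ⟨hne.symm, hv⟩⟩
  · rintro ⟨v, w⟩ _
    rfl

/-- Removing v and then w from B gives an alternating sum over inserting v or not and w or not into
σ. It is symmetric in v and w, while the signs are antisymmetric. -/
theorem cubeBoundary_sq (x : Finset V × Finset V →₀ K) :
    cubeBoundary K (cubeBoundary K x) = 0 := by
  suffices h : cubeBoundary K ∘ₗ cubeBoundary K =
      (0 : (Finset V × Finset V →₀ K) →ₗ[K] _) from LinearMap.congr_fun h x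
  refine Finsupp.lhom_ext' fun ⟨σ, B⟩ => LinearMap.ext_ring ?_
  have hs : ∀ (τ C : Finset V) (a : K), Finsupp.single (τ, C) a = a • Finsupp.single (τ, C) (1 : K) :=
    fun τ C a => by simp
  have h1 : ∀ σ B : Finset V, cubeBoundary K (Finsupp.single (σ, B) 1) =
      ∑ v ∈ B, faceSign K B v • (Finsupp.single (σ, B.erase v) 1 -
        Finsupp.single (insert v σ, B.erase v) (1 : K)) := fun σ B => by
    rw [cubeBoundary, LinearMap.sub_apply, cubeLower_single, cubeUpper_single, ← Finset.sum_sub_distrib]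
    exact Finset.sum_congr rfl fun v _ => by rw [hs, hs (insert v σ), smul_sub]
  change cubeBoundary K (cubeBoundary K (Finsupp.single (σ, B) 1)) = 0
  rw [h1, map_sum]
  have h2 : ∀ v ∈ B, cubeBoundary K (faceSign K B v •
      (Finsupp.single (σ, B.erase v) 1 - Finsupp.single (insert v σ, B.erase v) 1)) =
      ∑ w ∈ B.erase v, (faceSign K B v * faceSign K (B.erase v) w) •
        (Finsupp.single (σ, (B.erase v).erase w) (1 : K) -
          Finsupp.single (insert w σ, (B.erase v).erase w) 1 -
          (Finsupp.single (insert v σ, (B.erase v).erase w) 1 -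
          Finsupp.single (insert w (insert v σ), (B.erase v).erase w) 1)) := fun v _ => by
    rw [map_smul, map_sub, h1, h1, ← Finset.sum_sub_distrib, Finset.smul_sum]
    exact Finset.sum_congr rfl fun w _ => by rw [← smul_sub, smul_smul]
  rw [Finset.sum_congr rfl h2]
  refine sum_sum_erase_eq_zero B _ fun v w => ?_
  rw [Finset.erase_right_comm, Finset.insert_comm]
  abel

end CubeComplex

/-! ### The differential on triples (A, σ, B). -/

section TotalComplex

variable (K : Type u) [Field K] {V : Type v}

/-- The operator that multiplies a simplex by the parity of its number of vertices. -/
noncomputable def signOp : (Finset V →₀ K) →ₗ[K] (Finset V →₀ K) :=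
  Finsupp.linearCombination K fun A => Finsupp.single A ((-1) ^ A.card)

variable {K} in
theorem signOp_single (A : Finset V) (a : K) :
    signOp K (Finsupp.single A a) = Finsupp.single A ((-1) ^ A.card * a) := by
  simp [signOp, mul_comm]

variable {K} in
theorem signOp_eq_smul {S : Set (Finset V)} {i : ℕ}
    (hS : ∀ σ ∈ S, σ.card = i) {x : Finset V →₀ K} (hx : x ∈ Finsupp.supported K K S) :
    signOp K x = (-1 : K) ^ i • x := by
  refine eq_of_supported (f := signOp K) (g := (-1 : K) ^ i • LinearMap.id) (fun σ hσ => ?_) hx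
  rw [signOp_single, hS σ hσ, LinearMap.smul_apply, LinearMap.id_apply, Finsupp.smul_single,
    smul_eq_mul]

variable [LinearOrder V]

variable {K} in
theorem relBoundary_single_mem (X : Complex V) (A : Finset V) (a : K) :
    relBoundary K X (Finsupp.single A a) ∈
      Finsupp.supported K K {A' | A' ⊆ A ∧ A' ∉ X ∧ A'.card + 1 = A.card} := by
  have h : boundary K (Finsupp.single A a) ∈
      Finsupp.supported K K {A' | A' ⊆ A ∧ A'.card + 1 = A.card} := by
    rw [boundary_single]
    exact Submodule.smul_mem _ _ (Submodule.sum_mem _ fun v hv => Finsupp.single_mem_supported K _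
      ⟨Finset.erase_subset v A, Finset.card_erase_add_one hv⟩)
  exact Finsupp.supported_mono (t := {A' | A' ⊆ A ∧ A' ∉ X ∧ A'.card + 1 = A.card})
    (fun _ h => ⟨h.1.1, h.2, h.1.2⟩) (suppProj_mem h)

-- The boundary drops exactly one vertex, which changes the parity; on the empty simplex both sides
-- vanish.
variable {K} in
theorem relBoundary_signOp (X : Complex V) (x : Finset V →₀ K) :
    relBoundary K X (signOp K x) = -signOp K (relBoundary K X x) := by
  suffices h : relBoundary K X ∘ₗ signOp K = -(signOp K ∘ₗ relBoundary K X) from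
    LinearMap.congr_fun h x
  refine Finsupp.lhom_ext' fun A => LinearMap.ext_ring ?_
  change relBoundary K X (signOp K (Finsupp.single A 1)) =
    -signOp K (relBoundary K X (Finsupp.single A 1))
  rcases Finset.eq_empty_or_nonempty A with rfl | hA
  · simp [signOp_single, relBoundary, boundary]
  · have hc : A.card - 1 + 1 = A.card := Nat.sub_add_cancel hA.card_pos
    have hpow : (-1 : K) ^ A.card = -(-1) ^ (A.card - 1) := by
      conv_lhs => rw [← hc, pow_succ, mul_neg_one]
    rw [signOp_eq_smul (i := A.card - 1) (fun σ hσ => by have := hσ.2.2; omega)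
      (relBoundary_single_mem X A 1), signOp_single, mul_one, ← mul_one ((-1 : K) ^ A.card),
      ← smul_eq_mul, ← Finsupp.smul_single, map_smul, hpow, neg_smul]

/-- The differential of the complex spanned by the triples `(A, σ, B)`, where `(σ, B)` stands for
the cube `[σ, σ ∪ B]`. -/
noncomputable def totalBoundary (X : Complex V) :
    (Finset V × Finset V × Finset V →₀ K) →ₗ[K] (Finset V × Finset V × Finset V →₀ K) :=
  (finsuppTensorFinsupp' K (Finset V) (Finset V × Finset V)).toLinearMap ∘ₗ
    tensorDifferential (relBoundary K X) (signOp K) (cubeBoundary K) ∘ₗ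
      (finsuppTensorFinsupp' K (Finset V) (Finset V × Finset V)).symm.toLinearMap

theorem totalBoundary_sq (X : Complex V) (x : Finset V × Finset V × Finset V →₀ K) :
    totalBoundary K X (totalBoundary K X x) = 0 := by
  simp only [totalBoundary, LinearMap.comp_apply, LinearEquiv.coe_coe, LinearEquiv.symm_apply_apply]
  rw [tensorDifferential_sq (relBoundary_relBoundary X) cubeBoundary_sq (relBoundary_signOp X),
    map_zero]

end TotalComplex

/-! ### The total complex computes the homology of (Y, X ∩ Y). -/

section TotalChains

open scoped TensorProduct

variable (K : Type u) [Field K] {V : Type v}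

/-- The section `A ↦ (A, A, ∅)` of `bottomMap`. -/
noncomputable def diagMap : (Finset V →₀ K) →ₗ[K] (Finset V × Finset V × Finset V →₀ K) :=
  Finsupp.linearCombination K fun A => Finsupp.single (A, A, ∅) 1

variable {K} in
theorem diagMap_single (A : Finset V) (a : K) :
    diagMap K (Finsupp.single A a) = Finsupp.single (A, A, ∅) a := by
  simp [diagMap]

variable [LinearOrder V]

/-- The triples `(A, σ, B)` with `A ⊆ σ`, `A ∉ X`, `B ∈ lk(Y, σ)`. -/
def flagTriples (X Y : Complex V) : Set (Finset V × Finset V × Finset V) :=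
  {t | t.1 ⊆ t.2.1 ∧ t.1 ∉ X ∧ Disjoint t.2.1 t.2.2 ∧ t.2.1 ∪ t.2.2 ∈ Y}

/-- The degree of a triple. -/
def tripleDeg (t : Finset V × Finset V × Finset V) : ℤ := simplexDim t.1 + t.2.2.card

/-- The chains of degree `m` of the total complex. -/
def totalChains (X Y : Complex V) (m : ℤ) : Submodule K (Finset V × Finset V × Finset V →₀ K) :=
  Finsupp.supported K K {t | t ∈ flagTriples X Y ∧ tripleDeg t = m}

variable {K}

theorem tensor_mem_supported {α β : Type*} {S : Set α} {T : Set β} {x : α →₀ K} {y : β →₀ K}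
    (hx : x ∈ Finsupp.supported K K S) (hy : y ∈ Finsupp.supported K K T) :
    finsuppTensorFinsupp' K α β (x ⊗ₜ y) ∈ Finsupp.supported K K (S ×ˢ T) := by
  rw [Finsupp.mem_supported'] at hx hy ⊢
  rintro ⟨a, b⟩ h
  rw [finsuppTensorFinsupp'_apply_apply]
  by_cases ha : a ∈ S
  · rw [hy b fun hb => h ⟨ha, hb⟩, mul_zero]
  · rw [hx a ha, zero_mul]

theorem tensor_single_sum {α β ι : Type*} (a : α) (s : Finset ι) (b : ι → β) (c : ι → K) :
    finsuppTensorFinsupp' K α β (Finsupp.single a 1 ⊗ₜ ∑ i ∈ s, Finsupp.single (b i) (c i)) =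
      ∑ i ∈ s, Finsupp.single (a, b i) (c i) := by
  rw [TensorProduct.tmul_sum, map_sum]
  simp

variable (K) in
/-- The part of the differential of the total complex that enlarges `σ`, up to sign. -/
noncomputable def upperMap :
    (Finset V × Finset V × Finset V →₀ K) →ₗ[K] (Finset V × Finset V × Finset V →₀ K) :=
  Finsupp.linearCombination K fun t => (-1 : K) ^ t.1.card •
    ∑ v ∈ t.2.2, Finsupp.single (t.1, insert v t.2.1, t.2.2.erase v) (faceSign K t.2.2 v)

theorem upperMap_single (A σ B : Finset V) : upperMap K (Finsupp.single (A, σ, B) 1) =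
    (-1 : K) ^ A.card • ∑ v ∈ B, Finsupp.single (A, insert v σ, B.erase v) (faceSign K B v) := by
  simp [upperMap]

theorem totalBoundary_single (X : Complex V) (A σ B : Finset V) :
    totalBoundary K X (Finsupp.single (A, σ, B) 1) =
      finsuppTensorFinsupp' K _ _ (relBoundary K X (Finsupp.single A 1) ⊗ₜ
        Finsupp.single (σ, B) 1) +
      (-1 : K) ^ A.card • (∑ v ∈ B, Finsupp.single (A, σ, B.erase v) (faceSign K B v) -
        ∑ v ∈ B, Finsupp.single (A, insert v σ, B.erase v) (faceSign K B v)) := by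
  rw [totalBoundary, LinearMap.comp_apply, LinearMap.comp_apply, LinearEquiv.coe_coe,
    LinearEquiv.coe_coe, finsuppTensorFinsupp'_symm_single_eq_single_one_tmul,
    tensorDifferential_tmul, map_add, signOp_single, cubeBoundary, LinearMap.sub_apply,
    cubeLower_single, cubeUpper_single, TensorProduct.tmul_sub, map_sub, ← smul_eq_mul,
    ← Finsupp.smul_single, ← TensorProduct.smul_tmul', ← TensorProduct.smul_tmul', map_smul,
    map_smul, tensor_single_sum, tensor_single_sum, smul_sub]

variable (K) in
/-- The part of the differential of the total complex that preserves `σ`. -/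
noncomputable def lowerMap (X : Complex V) :
    (Finset V × Finset V × Finset V →₀ K) →ₗ[K] (Finset V × Finset V × Finset V →₀ K) :=
  totalBoundary K X + upperMap K

theorem lowerMap_single (X : Complex V) (A σ B : Finset V) :
    lowerMap K X (Finsupp.single (A, σ, B) 1) =
      finsuppTensorFinsupp' K _ _ (relBoundary K X (Finsupp.single A 1) ⊗ₜ
        Finsupp.single (σ, B) 1) +
      (-1 : K) ^ A.card • ∑ v ∈ B, Finsupp.single (A, σ, B.erase v) (faceSign K B v) := by
  rw [lowerMap, LinearMap.add_apply, totalBoundary_single, upperMap_single, smul_sub]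
  abel

/-- A vertex moves from B to σ, so σ ∪ B, and with it membership in Y, is unchanged. The weight is
unchanged too. -/
theorem upperMap_single_mem {X Y : Complex V} {t : Finset V × Finset V × Finset V}
    (ht : t ∈ flagTriples X Y) :
    upperMap K (Finsupp.single t 1) ∈ Finsupp.supported K K {t' | t' ∈ flagTriples X Y ∧
      t'.1 = t.1 ∧ t'.2.1.card = t.2.1.card + 1 ∧ t'.2.2.card + 1 = t.2.2.card} := by
  obtain ⟨A, σ, B⟩ := t
  obtain ⟨h1, h2, h3, h4⟩ := ht
  dsimp only at h1 h2 h3 h4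
  rw [upperMap_single]
  refine Submodule.smul_mem _ _ (Submodule.sum_mem _ fun v hv => Finsupp.single_mem_supported K _
    ⟨⟨?_, h2, ?_, ?_⟩, rfl, ?_, Finset.card_erase_add_one hv⟩)
  · exact h1.trans (Finset.subset_insert _ _)
  · rw [Finset.disjoint_insert_left]
    exact ⟨Finset.notMem_erase _ _, h3.mono_right (Finset.erase_subset _ _)⟩
  · dsimp only
    rwa [Finset.insert_union, ← Finset.union_insert, Finset.insert_erase hv]
  · exact Finset.card_insert_of_notMem (Finset.disjoint_right.1 h3 hv)

/-- A vertex is lost from A or from B while σ stays, so degree and weight both drop by one. -/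
theorem lowerMap_single_mem {X Y : Complex V} {t : Finset V × Finset V × Finset V}
    (ht : t ∈ flagTriples X Y) :
    lowerMap K X (Finsupp.single t 1) ∈ Finsupp.supported K K {t' | t' ∈ flagTriples X Y ∧
      t'.2.1 = t.2.1 ∧ t'.1.card + t'.2.2.card + 1 = t.1.card + t.2.2.card} := by
  obtain ⟨A, σ, B⟩ := t
  obtain ⟨h1, h2, h3, h4⟩ := ht
  dsimp only at h1 h2 h3 h4
  rw [lowerMap_single]
  refine add_mem ?_ (Submodule.smul_mem _ _ (Submodule.sum_mem _ fun v hv =>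
    Finsupp.single_mem_supported K _ ⟨⟨h1, h2, ?_, ?_⟩, rfl, ?_⟩))
  · refine Finsupp.supported_mono ?_ (tensor_mem_supported (relBoundary_single_mem X A 1)
      (Finsupp.single_mem_supported K 1 (Set.mem_singleton (σ, B))))
    rintro ⟨A', σ', B'⟩ ⟨⟨ha, hb, hc⟩, hσ⟩
    obtain ⟨rfl, rfl⟩ := Prod.mk.inj (Set.mem_singleton_iff.1 hσ)
    dsimp only at ha hb hc
    refine ⟨⟨ha.trans h1, hb, h3, h4⟩, rfl, ?_⟩
    dsimp only
    omega
  · exact h3.mono_right (Finset.erase_subset _ _)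
  · exact Y.lower (Finset.union_subset_union_right (Finset.erase_subset _ _)) h4
  · have := Finset.card_erase_add_one hv
    dsimp only
    omega

theorem totalBoundary_eq (X : Complex V) (x : Finset V × Finset V × Finset V →₀ K) :
    totalBoundary K X x = lowerMap K X x - upperMap K x := by
  rw [lowerMap, LinearMap.add_apply, add_sub_cancel_right]

theorem totalBoundary_mem (X Y : Complex V) {i : ℤ} {x : Finset V × Finset V × Finset V →₀ K}
    (hx : x ∈ totalChains K X Y (i + 1)) : totalBoundary K X x ∈ totalChains K X Y i := by
  refine map_mem_of_supported (fun t ht => ?_) hx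
  have hdeg := ht.2
  rw [totalBoundary_eq]
  refine sub_mem (Finsupp.supported_mono ?_ (lowerMap_single_mem ht.1))
    (Finsupp.supported_mono ?_ (upperMap_single_mem ht.1))
  · rintro t' ⟨h1, h2, h3⟩
    refine ⟨h1, ?_⟩
    simp only [tripleDeg, simplexDim] at hdeg ⊢
    omega
  · rintro t' ⟨h1, h2, h3, h4⟩
    refine ⟨h1, ?_⟩
    simp only [tripleDeg, simplexDim, h2] at hdeg ⊢
    omega

variable (K) in
/-- The projection of the total complex onto the relative chains. -/
noncomputable def bottomMap : (Finset V × Finset V × Finset V →₀ K) →ₗ[K] (Finset V →₀ K) :=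
  Finsupp.linearCombination K fun t => if t.2.2 = ∅ then Finsupp.single t.1 1 else 0

theorem bottomMap_single (A σ B : Finset V) (a : K) :
    bottomMap K (Finsupp.single (A, σ, B) a) = if B = ∅ then Finsupp.single A a else 0 := by
  simp [bottomMap]

theorem bottomMap_tensor (x : Finset V →₀ K) (σ B : Finset V) :
    bottomMap K (finsuppTensorFinsupp' K _ _ (x ⊗ₜ Finsupp.single (σ, B) 1)) =
      if B = ∅ then x else 0 := by
  induction x using Finsupp.induction_linear with
  | zero => simp
  | add f g hf hg => rw [TensorProduct.add_tmul, map_add, map_add, hf, hg]; split_ifs <;> simp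
  | single A a => rw [finsuppTensorFinsupp'_single_tmul_single, bottomMap_single, mul_one]

/-- `bottomMap` forgets σ, so opposite upper and lower faces of a cube have equal images and cancel;
only the boundary of A remains. -/
theorem bottomMap_totalBoundary (X : Complex V) (x : Finset V × Finset V × Finset V →₀ K) :
    bottomMap K (totalBoundary K X x) = relBoundary K X (bottomMap K x) := by
  refine eq_of_supported (S := Set.univ) (f := bottomMap K ∘ₗ totalBoundary K X)
    (g := relBoundary K X ∘ₗ bottomMap K) (fun t _ => ?_) (by simp)
  obtain ⟨A, σ, B⟩ := t
  rw [LinearMap.comp_apply, LinearMap.comp_apply, totalBoundary_single, map_add, bottomMap_tensor,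
    bottomMap_single, map_smul, map_sub, map_sum, map_sum]
  simp only [bottomMap_single, sub_self, smul_zero, add_zero]
  split_ifs <;> simp

theorem bottomMap_diagMap (x : Finset V →₀ K) : bottomMap K (diagMap K x) = x := by
  refine eq_of_supported (S := Set.univ) (f := bottomMap K ∘ₗ diagMap K) (g := LinearMap.id)
    (fun A _ => ?_) (by simp)
  rw [LinearMap.comp_apply, diagMap_single, bottomMap_single, if_pos rfl, LinearMap.id_apply]

variable (K) in
/-- The operator that fills a cube `[σ, C]` in the direction of the least element of `C \ A`. -/
noncomputable def fillMap :
    (Finset V × Finset V × Finset V →₀ K) →ₗ[K] (Finset V × Finset V × Finset V →₀ K) :=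
  Finsupp.linearCombination K fun t =>
    if h : ((t.2.1 ∪ t.2.2) \ t.1).Nonempty then
      if Finset.min' _ h ∈ t.2.1 then
        Finsupp.single (t.1, t.2.1.erase (Finset.min' _ h), insert (Finset.min' _ h) t.2.2)
          (-(-1 : K) ^ t.1.card)
      else 0
    else 0

theorem fillMap_single_of_empty {A σ B : Finset V} (h : (σ ∪ B) \ A = ∅) (a : K) :
    fillMap K (Finsupp.single (A, σ, B) a) = 0 := by
  simp [fillMap, h]

theorem fillMap_single {A σ B : Finset V} {w : V} (hw : IsLeast (↑((σ ∪ B) \ A) : Set V) w)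
    (a : K) : fillMap K (Finsupp.single (A, σ, B) a) =
      if w ∈ σ then Finsupp.single (A, σ.erase w, insert w B) (-(-1) ^ A.card * a) else 0 := by
  have hne : ((σ ∪ B) \ A).Nonempty := ⟨w, hw.1⟩
  have hmin : Finset.min' _ hne = w := (Finset.isLeast_min' _ hne).unique hw
  rw [fillMap, Finsupp.linearCombination_single, dif_pos hne]
  simp only [hmin, smul_ite, Finsupp.smul_single, smul_eq_mul, smul_zero, mul_comm a]

theorem fillMap_single_mem {X Y : Complex V} {t : Finset V × Finset V × Finset V}
    (ht : t ∈ flagTriples X Y) :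
    fillMap K (Finsupp.single t 1) ∈ Finsupp.supported K K {t' | t' ∈ flagTriples X Y ∧
      t'.1 = t.1 ∧ t'.2.1.card + 1 = t.2.1.card ∧ t'.2.2.card = t.2.2.card + 1} := by
  obtain ⟨A, σ, B⟩ := t
  obtain ⟨h1, h2, h3, h4⟩ := ht
  dsimp only at h1 h2 h3 h4
  rcases Finset.eq_empty_or_nonempty ((σ ∪ B) \ A) with h | h
  · rw [fillMap_single_of_empty h]
    exact zero_mem _
  · rw [fillMap_single (Finset.isLeast_min' _ h)]
    have hw := Finset.min'_mem _ h
    set w := Finset.min' _ h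
    split_ifs with hwσ
    · refine Finsupp.single_mem_supported K _ ⟨⟨?_, h2, ?_, ?_⟩, rfl,
        Finset.card_erase_add_one hwσ,
        Finset.card_insert_of_notMem (Finset.disjoint_left.1 h3 hwσ)⟩
      · exact fun a ha => Finset.mem_erase.2
          ⟨fun e => (Finset.mem_sdiff.1 hw).2 (e ▸ ha), h1 ha⟩
      · rw [Finset.disjoint_insert_right]
        exact ⟨Finset.notMem_erase _ _, h3.mono_left (Finset.erase_subset _ _)⟩
      · dsimp only
        rwa [Finset.union_insert, ← Finset.insert_union, Finset.insert_erase hwσ]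
    · exact zero_mem _

theorem bottomMap_fillMap (x : Finset V × Finset V × Finset V →₀ K) :
    bottomMap K (fillMap K x) = 0 := by
  suffices h : bottomMap K ∘ₗ fillMap K =
      (0 : (Finset V × Finset V × Finset V →₀ K) →ₗ[K] _) from LinearMap.congr_fun h x
  refine Finsupp.lhom_ext fun ⟨A, σ, B⟩ a => ?_
  rw [LinearMap.comp_apply, LinearMap.zero_apply]
  rcases Finset.eq_empty_or_nonempty ((σ ∪ B) \ A) with h | h
  · rw [fillMap_single_of_empty h, map_zero]
  · rw [fillMap_single (Finset.isLeast_min' _ h)]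
    split_ifs
    · rw [bottomMap_single, if_neg (Finset.insert_ne_empty _ _)]
    · exact map_zero _

/-- The filling operator contracts the upper part of the differential. -/
theorem fillMap_homotopy {A σ B : Finset V} (hA : A ⊆ σ) (hd : Disjoint σ B) (h : ((σ ∪ B) \ A).Nonempty) :
    upperMap K (fillMap K (Finsupp.single (A, σ, B) 1)) +
      fillMap K (upperMap K (Finsupp.single (A, σ, B) 1)) = -Finsupp.single (A, σ, B) 1 := by
  have hw := Finset.isLeast_min' _ h
  set w := Finset.min' _ h
  have hwA : w ∉ A := (Finset.mem_sdiff.1 hw.1).2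
  have hsq : (-1 : K) ^ A.card * (-1) ^ A.card = 1 := by
    rw [← mul_pow, neg_one_mul, neg_neg, one_pow]
  -- An upper face has the same union σ ∪ B, hence the same least vertex w outside A.
  have hfill : ∀ v ∈ B, ∀ a : K,
      fillMap K (Finsupp.single (A, insert v σ, B.erase v) a) =
        if w ∈ insert v σ then Finsupp.single (A, (insert v σ).erase w, insert w (B.erase v))
          (-(-1) ^ A.card * a) else 0 := fun v hv a => by
    refine fillMap_single ?_ a
    rwa [Finset.insert_union, ← Finset.union_insert, Finset.insert_erase hv]
  have hup : fillMap K (upperMap K (Finsupp.single (A, σ, B) 1)) =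
      ∑ v ∈ B, if w ∈ insert v σ then
        Finsupp.single (A, (insert v σ).erase w, insert w (B.erase v)) (-faceSign K B v)
          else 0 := by
    rw [upperMap_single, map_smul, map_sum, Finset.smul_sum]
    refine Finset.sum_congr rfl fun v hv => ?_
    rw [hfill v hv]
    split_ifs
    · rw [Finsupp.smul_single, smul_eq_mul, ← mul_assoc, mul_neg, hsq, neg_one_mul]
    · exact smul_zero _
  have hmin : ∀ v ∈ B, w ≤ v := fun v hv => hw.2 (Finset.mem_coe.2 (Finset.mem_sdiff.2
    ⟨Finset.mem_union_right _ hv, fun hvA => Finset.disjoint_left.1 hd (hA hvA) hv⟩))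
  rw [hup, fillMap_single hw]
  -- If w ∈ σ, the upper face at w of the filled cube gives back the triple, and the other faces
  -- cancel against the second composite. If w ∈ B, only the upper face at w can be filled, and this
  -- returns the triple.
  by_cases hwσ : w ∈ σ
  · have hwB : w ∉ B := Finset.disjoint_left.1 hd hwσ
    rw [if_pos hwσ, ← smul_eq_mul, ← Finsupp.smul_single, map_smul, upperMap_single, smul_smul,
      neg_mul, hsq, neg_one_smul, Finset.sum_insert hwB, Finset.insert_erase hwσ,
      Finset.erase_insert hwB, faceSign_of_le (by simpa using hmin), neg_add, add_assoc,
      add_eq_left, ← Finset.sum_neg_distrib, ← Finset.sum_add_distrib]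
    refine Finset.sum_eq_zero fun v hv => ?_
    have hvw : v ≠ w := fun e => hwB (e ▸ hv)
    rw [if_pos (Finset.mem_insert_of_mem hwσ), faceSign_insert hwB ((hmin v hv).lt_of_ne' hvw),
      Finset.erase_insert_of_ne hvw.symm, Finset.erase_insert_of_ne hvw, neg_add_cancel]
  · have hwB : w ∈ B := (Finset.mem_union.1 (Finset.mem_sdiff.1 hw.1).1).resolve_left hwσ
    rw [if_neg hwσ, map_zero, zero_add, Finset.sum_eq_single_of_mem w hwB,
      if_pos (Finset.mem_insert_self _ _), Finset.erase_insert hwσ, Finset.insert_erase hwB,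
      faceSign_of_le hmin, Finsupp.single_neg]
    intro v _ hvw
    rw [if_neg]
    rw [Finset.mem_insert, not_or]
    exact ⟨hvw.symm, hwσ⟩

/-- The number of vertices of a triple. -/
def tripleWeight (t : Finset V × Finset V × Finset V) : ℕ := t.1.card + t.2.1.card + t.2.2.card

variable (K) in
/-- The chains of degree `m` that are spanned by triples of weight less than `N`. -/
def weightChains (X Y : Complex V) (m : ℤ) (N : ℕ) :
    Submodule K (Finset V × Finset V × Finset V →₀ K) :=
  Finsupp.supported K K {t | (t ∈ flagTriples X Y ∧ tripleDeg t = m) ∧ tripleWeight t < N}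

/-- Chains have finite support, so induction on the weight needs no bound on the faces of Y. -/
theorem exists_mem_weightChains {X Y : Complex V} {m : ℤ}
    {x : Finset V × Finset V × Finset V →₀ K} (hx : x ∈ totalChains K X Y m) :
    ∃ N, x ∈ weightChains K X Y m N :=
  ⟨x.support.sup tripleWeight + 1, (Finsupp.mem_supported K x).2 fun _ ht =>
    ⟨(Finsupp.mem_supported K x).1 hx ht, Nat.lt_succ_of_le (Finset.le_sup (Finset.mem_coe.1 ht))⟩⟩

theorem fillMap_mem {X Y : Complex V} {m : ℤ} {x : Finset V × Finset V × Finset V →₀ K}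
    (hx : x ∈ totalChains K X Y m) : fillMap K x ∈ totalChains K X Y (m + 1) := by
  refine map_mem_of_supported (fun t ht => Finsupp.supported_mono ?_ (fillMap_single_mem ht.1)) hx
  rintro t' ⟨h1, h2, h3, h4⟩
  have hdeg := ht.2
  refine ⟨h1, ?_⟩
  simp only [tripleDeg, h2, h4] at hdeg ⊢
  push_cast
  linarith

/-- The filling operator contracts the kernel of `bottomMap` up to terms of smaller weight. -/
theorem sub_homotopy_mem {X Y : Complex V} {m : ℤ} {N : ℕ}
    {x : Finset V × Finset V × Finset V →₀ K} (hx : x ∈ weightChains K X Y m (N + 1)) :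
    x - (totalBoundary K X (fillMap K x) + fillMap K (totalBoundary K X x)) -
      diagMap K (bottomMap K x) ∈ weightChains K X Y m N := by
  refine map_mem_of_supported (f := LinearMap.id - (totalBoundary K X ∘ₗ fillMap K +
    fillMap K ∘ₗ totalBoundary K X) - diagMap K ∘ₗ bottomMap K) (fun t ht => ?_) hx
  obtain ⟨⟨hmem, hdeg⟩, hN⟩ := ht
  -- `fillMap` keeps the weight and `lowerMap` lowers it, so both composites of the two are
  -- negligible.
  have hlow : fillMap K (lowerMap K X (Finsupp.single t 1)) ∈ weightChains K X Y m N := by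
    refine map_mem_of_supported (fun t' ht' => Finsupp.supported_mono ?_
      (fillMap_single_mem ht'.1)) (lowerMap_single_mem hmem)
    rintro t'' ⟨h1, h2, h3, h4⟩
    obtain ⟨-, h5, h6⟩ := ht'
    simp only [tripleWeight, tripleDeg, simplexDim] at hN hdeg
    rw [h5] at h3
    rw [← h2] at h6
    refine ⟨⟨h1, ?_⟩, ?_⟩
    · simp only [tripleDeg, simplexDim]
      omega
    · simp only [tripleWeight]
      omega
  have hfill : lowerMap K X (fillMap K (Finsupp.single t 1)) ∈ weightChains K X Y m N := by
    refine map_mem_of_supported (fun t' ht' => Finsupp.supported_mono ?_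
      (lowerMap_single_mem ht'.1)) (fillMap_single_mem hmem)
    rintro t'' ⟨h1, h2, h3⟩
    obtain ⟨-, h4, h5, h6⟩ := ht'
    simp only [tripleWeight, tripleDeg, simplexDim] at hN hdeg
    rw [h4] at h3
    rw [← h2] at h5
    refine ⟨⟨h1, ?_⟩, ?_⟩
    · simp only [tripleDeg, simplexDim]
      omega
    · simp only [tripleWeight]
      omega
  simp only [LinearMap.sub_apply, LinearMap.add_apply, LinearMap.comp_apply, LinearMap.id_apply,
    totalBoundary_eq, map_sub]
  obtain ⟨A, σ, B⟩ := t
  obtain ⟨h1, h2, h3, h4⟩ := hmem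
  dsimp only at h1 h2 h3 h4
  rcases Finset.eq_empty_or_nonempty ((σ ∪ B) \ A) with h | h
  -- Nothing can be filled exactly when A = σ and B = ∅; there `diagMap ∘ bottomMap` is the identity
  -- and takes over.
  · have hCA := Finset.sdiff_eq_empty_iff_subset.1 h
    obtain rfl : A = σ := h1.antisymm (Finset.subset_union_left.trans hCA)
    obtain rfl : B = ∅ := by
      rw [← Finset.disjoint_self_iff_empty]
      exact h3.mono_left (Finset.subset_union_right.trans hCA)
    have hup : upperMap K (Finsupp.single (A, A, (∅ : Finset V)) 1) = 0 := by
      rw [upperMap_single, Finset.sum_empty, smul_zero]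
    have hfill0 : fillMap K (Finsupp.single (A, A, (∅ : Finset V)) 1) = 0 :=
      fillMap_single_of_empty h 1
    rw [hfill0, map_zero, map_zero, bottomMap_single, if_pos rfl, diagMap_single, hup, map_zero]
    convert neg_mem hlow using 1
    abel
  · have hhom := fillMap_homotopy (K := K) h1 h3 h
    -- For B = ∅ and A ≠ σ, the triple (A, A, ∅) has fewer vertices than (A, σ, ∅).
    have hdiag : diagMap K (bottomMap K (Finsupp.single (A, σ, B) 1)) ∈
        weightChains K X Y m N := by
      rw [bottomMap_single]
      split_ifs with hB
      · rw [diagMap_single]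
        subst hB
        rw [Finset.union_empty] at h h4
        refine Finsupp.single_mem_supported K _ ⟨⟨⟨subset_rfl, h2, disjoint_bot_right, ?_⟩, ?_⟩, ?_⟩
        · dsimp only
          rw [Finset.union_empty]
          exact Y.lower h1 h4
        · exact hdeg
        · have hlt : A.card < σ.card := Finset.card_lt_card
            ⟨h1, fun h' => h.ne_empty (Finset.sdiff_eq_empty_iff_subset.2 h')⟩
          simp only [tripleWeight] at hN ⊢
          omega
      · rw [map_zero]
        exact zero_mem _
    have hsum := sub_mem (neg_mem (add_mem hfill hlow)) hdiag
    generalize upperMap K (fillMap K (Finsupp.single (A, σ, B) 1)) = a₁ at hhom ⊢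
    generalize fillMap K (upperMap K (Finsupp.single (A, σ, B) 1)) = a₂ at hhom ⊢
    generalize fillMap K (lowerMap K X (Finsupp.single (A, σ, B) 1)) = a₃ at hsum ⊢
    generalize lowerMap K X (fillMap K (Finsupp.single (A, σ, B) 1)) = a₄ at hsum ⊢
    generalize diagMap K (bottomMap K (Finsupp.single (A, σ, B) 1)) = a₅ at hsum ⊢
    rw [show Finsupp.single (A, σ, B) (1 : K) = -(a₁ + a₂) by rw [hhom, neg_neg]]
    convert hsum using 1
    abel

/-- For a cycle x killed by `bottomMap`, subtracting the boundary of `fillMap K x` leaves another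
such cycle, of smaller weight by `sub_homotopy_mem`; induct on the weight. -/
theorem exists_totalBoundary_eq {X Y : Complex V} (m : ℤ)
    (x : Finset V × Finset V × Finset V →₀ K) (hx : x ∈ totalChains K X Y m)
    (hdx : totalBoundary K X x = 0) (hfx : bottomMap K x = 0) :
    ∃ z ∈ totalChains K X Y (m + 1), totalBoundary K X z = x ∧ bottomMap K z = 0 := by
  obtain ⟨N, hN⟩ := exists_mem_weightChains hx
  clear hx
  induction N generalizing x with
  | zero =>
    have h0 : x = 0 := by
      ext t
      exact (Finsupp.mem_supported' K x).1 hN t fun ht => Nat.not_lt_zero _ ht.2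
    exact ⟨0, zero_mem _, by rw [h0, map_zero], map_zero _⟩
  | succ N ih =>
    have hmem := sub_homotopy_mem hN
    rw [hdx, hfx, map_zero, map_zero, add_zero, sub_zero] at hmem
    obtain ⟨z, hz, hz1, hz2⟩ := ih _ (by rw [map_sub, hdx, totalBoundary_sq, sub_zero])
      (by rw [map_sub, hfx, bottomMap_totalBoundary, bottomMap_fillMap, map_zero, sub_zero]) hmem
    exact ⟨fillMap K x + z, add_mem (fillMap_mem (Finsupp.supported_mono (fun t ht => ht.1) hN)) hz,
      by rw [map_add, hz1, add_sub_cancel], by rw [map_add, hz2, bottomMap_fillMap, add_zero]⟩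

variable (K) in
/-- The homology of the total complex is the relative homology of `(Y, X ∩ Y)`. -/
theorem nonempty_totalHomology_equiv (X Y : Complex V) (m : ℤ) :
    Nonempty (SubHomology (totalBoundary K X) (totalChains K X Y m) (totalChains K X Y (m + 1))
      ≃ₗ[K] SubHomology (relBoundary K X) (relChains K X Y m) (relChains K X Y (m + 1))) := by
  refine nonempty_subHomology_equiv (totalBoundary_sq K X) (totalChains K X Y) (relChains K X Y)
    (fun i x hx => totalBoundary_mem X Y hx) (bottomMap K) (diagMap K) (fun i x hx => ?_)
    (fun i y hy => ?_) (fun i y _ => bottomMap_diagMap y) (fun i x _ => bottomMap_totalBoundary X x)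
    (fun i x hx => exists_totalBoundary_eq i x hx) m
  · refine map_mem_of_supported (fun t ht => ?_) hx
    obtain ⟨A, σ, B⟩ := t
    obtain ⟨⟨h1, h2, h3, h4⟩, h5⟩ := ht
    rw [bottomMap_single]
    split_ifs with hB
    · subst hB
      refine Finsupp.single_mem_supported K _
        ⟨Y.lower (h1.trans Finset.subset_union_left) h4, h2, ?_⟩
      simpa [tripleDeg] using h5
    · exact zero_mem _
  · refine map_mem_of_supported (fun A hA => ?_) hy
    rw [diagMap_single]
    refine Finsupp.single_mem_supported K _ ⟨⟨subset_rfl, hA.2.1, disjoint_bot_right, ?_⟩, ?_⟩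
    · dsimp only
      rw [Finset.union_empty]
      exact hA.1
    · simpa [tripleDeg] using hA.2.2

end TotalChains

/-! ### Künneth for a single σ. -/

section StratumContraction

variable (K : Type u) [Field K] {V : Type v}

/-- The only simplex of negative dimension is ∅, which lies in X. -/
theorem relChains_eq_bot {X : Complex V} (hX : ∅ ∈ X) (Z : Complex V) {i : ℤ} (hi : i < 0) :
    relChains K X Z i = ⊥ := by
  rw [← Finsupp.supported_empty (α := Finset V) (M := K) (R := K), relChains]
  congr 1
  refine Set.eq_empty_of_forall_notMem ?_
  rintro σ ⟨-, h1, h2⟩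
  have : σ.card = 0 := by
    simp only [simplexDim] at h2
    omega
  exact h1 (Finset.card_eq_zero.1 this ▸ hX)

theorem chains_eq_bot (Z : Complex V) {i : ℤ} (hi : i < -1) : chains K Z i = ⊥ := by
  rw [← Finsupp.supported_empty (α := Finset V) (M := K) (R := K), chains]
  congr 1
  refine Set.eq_empty_of_forall_notMem ?_
  rintro σ ⟨-, h⟩
  simp only [simplexDim] at h
  omega

variable {K} in
theorem signOp_relChains {X : Complex V} (hX : ∅ ∈ X) (Z : Complex V) (i : ℤ)
    {x : Finset V →₀ K} (hx : x ∈ relChains K X Z i) : signOp K x = (-1 : K) ^ (i + 1) • x := by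
  rcases lt_or_ge i 0 with hi | hi
  · rw [relChains_eq_bot K hX Z hi, Submodule.mem_bot] at hx
    rw [hx, map_zero, smul_zero]
  · lift i to ℕ using hi
    rw [signOp_eq_smul (i := i + 1) (fun σ hσ => ?_) hx]
    · norm_cast
    · have := hσ.2.2
      simp only [simplexDim] at this
      omega

variable [LinearOrder V]

/-- The Künneth contraction for the pair of the simplex on `σ` modulo `X` and the link of `σ`. -/
theorem nonempty_stratumContraction {X : Complex V} (hX : ∅ ∈ X) (Z : Complex V) {σ : Finset V}
    (hσ : σ.Nonempty) :
    Nonempty (Contraction (tensorDifferential (relBoundary K X) (signOp K) (boundary K))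
      (tensorGrading (relChains K X (LowerSet.Iic σ)) fun j => chains K Z (j - 1))
      (tensorSum K (fun i => reducedHomology K (induced X σ) (i - 1))
        fun j => reducedHomology K Z (j - 1))) := by
  have e₁ : ∀ i, Nonempty (SubHomology (relBoundary K X) (relChains K X (LowerSet.Iic σ) i)
      (relChains K X (LowerSet.Iic σ) (i + 1)) ≃ₗ[K]
      reducedHomology K (induced X σ) (i - 1)) := fun i => by
    obtain ⟨e⟩ := nonempty_connecting_equiv K X (LowerSet.Iic σ)
      (exists_boundary_eq_of_simplex hσ) i
    obtain ⟨e'⟩ := nonempty_reducedHomology_equiv K (induced X σ) (i - 1)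
    rw [sub_add_cancel] at e'
    -- The complexes `X ⊓ LowerSet.Iic σ` and `induced X σ` agree by definition.
    exact ⟨e.trans e'⟩
  have e₂ : ∀ j, Nonempty (SubHomology (boundary K) (chains K Z (j - 1)) (chains K Z (j + 1 - 1))
      ≃ₗ[K] reducedHomology K Z (j - 1)) := fun j => by
    obtain ⟨e⟩ := nonempty_reducedHomology_equiv K Z (j - 1)
    rw [sub_add_cancel] at e
    rw [add_sub_cancel_right]
    exact ⟨e⟩
  have hd₁ : ∀ i, ∀ x ∈ relChains K X (LowerSet.Iic σ) (i + 1),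
      relBoundary K X x ∈ relChains K X (LowerSet.Iic σ) i :=
    fun i x hx => relBoundary_mem_relChains X _ rfl hx
  have hd₂ : ∀ j, ∀ x ∈ chains K Z (j + 1 - 1), boundary K x ∈ chains K Z (j - 1) :=
    fun j x hx => boundary_mem_chains K Z (by ring) x hx
  obtain ⟨c₁⟩ := nonempty_contraction (relBoundary K X) (relBoundary_relBoundary X)
    (relChains K X (LowerSet.Iic σ)) _ (fun _ => rfl) simplexDim (fun i A hA => hA.2.2) hd₁
    (fun i => reducedHomology K (induced X σ) (i - 1)) fun i => (e₁ i).some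
  -- A simplex B of the link has degree |B| = dim B + 1 in the total complex, hence the shift by
  -- one.
  obtain ⟨c₂⟩ := nonempty_contraction (boundary K) (boundary_boundary K)
    (fun j => chains K Z (j - 1)) (fun j => {τ | τ ∈ Z ∧ simplexDim τ = j - 1}) (fun _ => rfl)
    (fun τ => simplexDim τ + 1) (fun j B hB => by rw [hB.2]; ring) hd₂
    (fun j => reducedHomology K Z (j - 1)) fun j => (e₂ j).some
  exact ⟨c₁.tensor c₂ (signOp K) (fun i => (-1) ^ (i + 1))
    (fun i => by rw [zpow_add_one₀ (by simp), mul_neg_one])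
    (fun i => by rw [← mul_zpow, neg_one_mul, neg_neg, one_zpow])
    (fun i x hx => signOp_relChains hX _ i hx) (fun i hi => relChains_eq_bot K hX _ hi)
    (fun j hj => chains_eq_bot K Z (by linarith)) hd₁ hd₂⟩

end StratumContraction

/-! ### The filtration by the codimension of σ and its strata. -/

section Filtration

open scoped TensorProduct

variable (K : Type u) [Field K] {V : Type v}

/-- The inclusion of the stratum of the triples with a fixed `σ`. -/
noncomputable def stratumIncl (σ : Finset V) :
    (Finset V →₀ K) ⊗[K] (Finset V →₀ K) →ₗ[K] (Finset V × Finset V × Finset V →₀ K) :=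
  (finsuppTensorFinsupp' K (Finset V) (Finset V × Finset V)).toLinearMap ∘ₗ
    TensorProduct.map LinearMap.id (Finsupp.lmapDomain K K fun B => (σ, B))

variable {K}

theorem stratumIncl_single (σ A B : Finset V) :
    stratumIncl K σ (Finsupp.single A 1 ⊗ₜ Finsupp.single B 1) = Finsupp.single (A, σ, B) 1 := by
  simp [stratumIncl]

theorem tensor_ext_single {L : Type*} [AddCommGroup L] [Module K L]
    {f g : (Finset V →₀ K) ⊗[K] (Finset V →₀ K) →ₗ[K] L}
    (h : ∀ A B : Finset V, f (Finsupp.single A 1 ⊗ₜ Finsupp.single B 1) =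
      g (Finsupp.single A 1 ⊗ₜ Finsupp.single B 1)) : f = g :=
  TensorProduct.ext (Finsupp.lhom_ext' fun A => LinearMap.ext_ring
    (Finsupp.lhom_ext' fun B => LinearMap.ext_ring (h A B)))

variable (K) [LinearOrder V]

/-- The filtration of the total complex by the codimension of `σ`. -/
def filtChains (X Y : Complex V) (n p m : ℤ) :
    Submodule K (Finset V × Finset V × Finset V →₀ K) :=
  Finsupp.supported K K {t | (t ∈ flagTriples X Y ∧ tripleDeg t = m) ∧ n - p ≤ simplexDim t.2.1}

theorem filtChains_mono (X Y : Complex V) (n m : ℤ) :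
    Monotone fun p => filtChains K X Y n p m := fun p p' hp =>
  Finsupp.supported_mono fun _ ht => ⟨ht.1, by have := ht.2; linarith⟩

/-- A ∉ X and ∅ ∈ X force A, hence σ, to be nonempty. So dim σ ≥ 0, and the filtration is exhausted
at p = n already. -/
theorem filtChains_eq_totalChains {X : Complex V} (hX : ∅ ∈ X) (Y : Complex V) {n p : ℤ}
    (hp : n ≤ p) (m : ℤ) : filtChains K X Y n p m = totalChains K X Y m := by
  refine le_antisymm (Finsupp.supported_mono fun t ht => ht.1)
    (Finsupp.supported_mono fun t ht => ⟨ht, ?_⟩)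
  have hA : t.1.Nonempty := Finset.nonempty_iff_ne_empty.2 fun h => ht.1.2.1 (h ▸ hX)
  have hσ := (hA.mono ht.1.1).card_pos
  simp only [simplexDim]
  omega

theorem filtChains_eq_bot (X : Complex V) {Y : Complex V} {n : ℤ} (hn : HasDim Y n) {p : ℤ}
    (hp : p < 0) (m : ℤ) : filtChains K X Y n p m = ⊥ := by
  rw [← Finsupp.supported_empty (α := Finset V × Finset V × Finset V) (M := K) (R := K),
    filtChains]
  congr 1
  refine Set.eq_empty_of_forall_notMem ?_
  rintro t ⟨⟨⟨-, -, -, h⟩, -⟩, h'⟩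
  have := hn.2 ⟨t.2.1, Y.lower Finset.subset_union_left h, rfl⟩
  linarith

variable {K}

/-- Enlarging σ by a vertex lowers the filtration, so this part of the differential is invisible on
the associated graded complex. -/
theorem upperMap_mem_filtChains {X Y : Complex V} {n p m : ℤ}
    {x : Finset V × Finset V × Finset V →₀ K} (hx : x ∈ filtChains K X Y n p (m + 1)) :
    upperMap K x ∈ filtChains K X Y n (p - 1) m := by
  refine map_mem_of_supported (fun t ht => Finsupp.supported_mono ?_
    (upperMap_single_mem ht.1.1)) hx
  rintro t' ⟨h1, h2, h3, h4⟩
  obtain ⟨⟨-, h5⟩, h6⟩ := ht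
  simp only [tripleDeg, simplexDim] at h5 h6
  rw [← h2] at h5
  refine ⟨⟨h1, ?_⟩, ?_⟩ <;> simp only [tripleDeg, simplexDim] <;> omega

theorem lowerMap_mem_filtChains {X Y : Complex V} {n p m : ℤ}
    {x : Finset V × Finset V × Finset V →₀ K} (hx : x ∈ filtChains K X Y n p (m + 1)) :
    lowerMap K X x ∈ filtChains K X Y n p m := by
  refine map_mem_of_supported (fun t ht => Finsupp.supported_mono ?_
    (lowerMap_single_mem ht.1.1)) hx
  rintro t' ⟨h1, h2, h3⟩
  obtain ⟨⟨-, h5⟩, h6⟩ := ht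
  simp only [tripleDeg, simplexDim] at h5
  rw [← h2] at h6
  refine ⟨⟨h1, ?_⟩, h6⟩
  simp only [tripleDeg, simplexDim]
  omega

/-- With σ fixed, lower faces of the cube are just faces of B, so the graded differential is that of
a tensor product. -/
theorem lowerMap_stratumIncl (X : Complex V) (σ : Finset V)
    (t : (Finset V →₀ K) ⊗[K] (Finset V →₀ K)) :
    lowerMap K X (stratumIncl K σ t) =
      stratumIncl K σ (tensorDifferential (relBoundary K X) (signOp K) (boundary K) t) := by
  suffices h : lowerMap K X ∘ₗ stratumIncl K σ = stratumIncl K σ ∘ₗ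
      tensorDifferential (relBoundary K X) (signOp K) (boundary K) from LinearMap.congr_fun h t
  refine tensor_ext_single fun A B => ?_
  rw [LinearMap.comp_apply, LinearMap.comp_apply, stratumIncl_single, lowerMap_single,
    tensorDifferential_tmul, map_add, signOp_single, boundary_single_one, ← smul_eq_mul,
    ← Finsupp.smul_single, ← TensorProduct.smul_tmul', map_smul]
  simp only [stratumIncl, LinearMap.comp_apply, LinearEquiv.coe_coe, TensorProduct.map_tmul,
    LinearMap.id_apply, map_sum, Finsupp.lmapDomain_apply, Finsupp.mapDomain_single,
    tensor_single_sum]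

theorem stratumIncl_mem {X Y : Complex V} {n p m : ℤ} {σ : Finset V} (hσ : σ ∈ Y)
    (hp : n - p ≤ simplexDim σ) {t : (Finset V →₀ K) ⊗[K] (Finset V →₀ K)}
    (ht : t ∈ tensorGrading (relChains K X (LowerSet.Iic σ))
      (fun j => chains K (link Y σ) (j - 1)) m) :
    stratumIncl K σ t ∈ filtChains K X Y n p m := by
  refine map_mem_of_tensorGrading (fun i j hij x hx y hy => ?_) ht
  have hy' : Finsupp.lmapDomain K K (fun B => (σ, B)) y ∈ Finsupp.supported K K
      {c : Finset V × Finset V | c.1 = σ ∧ c.2 ∈ link Y σ ∧ simplexDim c.2 = j - 1} := by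
    refine map_mem_of_supported (fun B hB => ?_) hy
    rw [Finsupp.lmapDomain_apply, Finsupp.mapDomain_single]
    exact Finsupp.single_mem_supported K _ ⟨rfl, hB⟩
  refine Finsupp.supported_mono ?_ (tensor_mem_supported hx hy')
  rintro ⟨A, σ', B⟩ ⟨⟨h1, h2, h3⟩, h4, h5, h6⟩
  dsimp only at h1 h2 h3 h4 h5 h6
  subst h4
  refine ⟨⟨⟨h1, h2, ?_, ?_⟩, ?_⟩, hp⟩
  · exact (Finset.disjoint_iff_inter_eq_empty.2 h5.2.2).symm
  · dsimp only
    rw [Finset.union_comm]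
    exact h5.2.1
  · simp only [tripleDeg, simplexDim] at h3 h6 ⊢
    omega

/-- A basis vector of the total complex lies in the stratum of its middle entry. -/
theorem single_mem_tensorGrading {X Y : Complex V} {m : ℤ} {A σ B : Finset V}
    (h : (A, σ, B) ∈ flagTriples X Y) (hm : tripleDeg (A, σ, B) = m) :
    (Finsupp.single A 1 ⊗ₜ Finsupp.single B 1 : (Finset V →₀ K) ⊗[K] (Finset V →₀ K)) ∈
      tensorGrading (relChains K X (LowerSet.Iic σ)) (fun j => chains K (link Y σ) (j - 1)) m := by
  obtain ⟨h1, h2, h3, h4⟩ := h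
  dsimp only at h1 h2 h3 h4
  refine tmul_mem_tensorGrading (i := simplexDim A) (j := B.card) hm
    (Finsupp.single_mem_supported K
      (s := {τ | τ ∈ LowerSet.Iic σ ∧ τ ∉ X ∧ simplexDim τ = simplexDim A}) _ ⟨h1, h2, rfl⟩) (Finsupp.single_mem_supported K
      (s := {τ | τ ∈ link Y σ ∧ simplexDim τ = (B.card : ℤ) - 1}) _
      ⟨⟨Y.lower Finset.subset_union_right h4, ?_, ?_⟩, rfl⟩)
  · rwa [Finset.union_comm]
  · exact Finset.disjoint_iff_inter_eq_empty.1 h3.symm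

end Filtration

/-! ### Gluing the contractions of the strata into the first page. -/

section FirstPage

open scoped TensorProduct DirectSum

variable {K : Type u} [Field K] {V : Type v} [LinearOrder V] {X Y : Complex V} {k : ℤ}
  {H : FacesOfDim Y k → ℤ → Type w} [∀ σ m, AddCommGroup (H σ m)] [∀ σ m, Module K (H σ m)]
  (c : ∀ σ : FacesOfDim Y k,
    Contraction (tensorDifferential (relBoundary K X) (signOp K) (boundary K))
      (tensorGrading (relChains K X (LowerSet.Iic σ.1)) fun j => chains K (link Y σ.1) (j - 1))
      (H σ))

open scoped Classical in
/-- The projection of the total complex onto the harmonic parts of the strata of dimension `k`. -/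
noncomputable def strataProj (m : ℤ) :
    (Finset V × Finset V × Finset V →₀ K) →ₗ[K] ⨁ σ, H σ m :=
  Finsupp.linearCombination K fun t =>
    if h : t.2.1 ∈ Y ∧ simplexDim t.2.1 = k then
      DirectSum.lof K (FacesOfDim Y k) (fun σ => H σ m) ⟨t.2.1, h⟩
        ((c ⟨t.2.1, h⟩).ρ m (Finsupp.single t.1 1 ⊗ₜ Finsupp.single t.2.2 1))
    else 0

theorem strataProj_stratumIncl (m : ℤ) (σ : FacesOfDim Y k)
    (t : (Finset V →₀ K) ⊗[K] (Finset V →₀ K)) :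
    strataProj c m (stratumIncl K σ.1 t) =
      DirectSum.lof K (FacesOfDim Y k) (fun σ => H σ m) σ ((c σ).ρ m t) := by
  suffices h : strataProj c m ∘ₗ stratumIncl K σ.1 =
      DirectSum.lof K (FacesOfDim Y k) (fun σ => H σ m) σ ∘ₗ (c σ).ρ m from
    LinearMap.congr_fun h t
  refine tensor_ext_single fun A B => ?_
  rw [LinearMap.comp_apply, LinearMap.comp_apply, stratumIncl_single, strataProj,
    Finsupp.linearCombination_single, one_smul, dif_pos σ.2]

theorem strataProj_eq_zero (m : ℤ) {n p m' : ℤ} (hk : k < n - p)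
    {x : Finset V × Finset V × Finset V →₀ K} (hx : x ∈ filtChains K X Y n p m') :
    strataProj c m x = 0 := by
  refine (Submodule.mem_bot K).1 (map_mem_of_supported (fun t ht => ?_) hx)
  rw [Submodule.mem_bot, strataProj, Finsupp.linearCombination_single, dif_neg, smul_zero]
  rintro ⟨-, h⟩
  have := ht.2
  linarith

/-- The inclusion of the harmonic parts of the strata of dimension `k`. -/
noncomputable def strataIncl (m : ℤ) :
    (⨁ σ, H σ m) →ₗ[K] (Finset V × Finset V × Finset V →₀ K) :=
  DirectSum.toModule K _ _ fun σ => stratumIncl K σ.1 ∘ₗ (c σ).ι m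

theorem strataIncl_lof (m : ℤ) (σ : FacesOfDim Y k) (y : H σ m) :
    strataIncl c m (DirectSum.lof K (FacesOfDim Y k) (fun σ => H σ m) σ y) =
      stratumIncl K σ.1 ((c σ).ι m y) :=
  DirectSum.toModule_lof (M := fun σ => H σ m) K σ y

theorem strataIncl_induction {m : ℤ} {L : Type*} [AddCommGroup L] [Module K L]
    {R : Submodule K L} (f : (⨁ σ, H σ m) →ₗ[K] L)
    (h : ∀ (σ : FacesOfDim Y k) (y : H σ m),
      f (DirectSum.lof K (FacesOfDim Y k) (fun σ => H σ m) σ y) ∈ R) (y : ⨁ σ, H σ m) :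
    f y ∈ R := by
  induction y using DirectSum.induction_on with
  | zero => rw [map_zero]; exact zero_mem _
  | of σ y => exact h σ y
  | add s t hs ht => rw [map_add]; exact add_mem hs ht

open scoped Classical in
/-- The homotopy on the strata of dimension `k`. -/
noncomputable def strataHomotopy :
    (Finset V × Finset V × Finset V →₀ K) →ₗ[K] (Finset V × Finset V × Finset V →₀ K) :=
  Finsupp.linearCombination K fun t =>
    if h : t.2.1 ∈ Y ∧ simplexDim t.2.1 = k then
      stratumIncl K t.2.1 ((c ⟨t.2.1, h⟩).h (Finsupp.single t.1 1 ⊗ₜ Finsupp.single t.2.2 1))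
    else 0

theorem strataHomotopy_stratumIncl (σ : FacesOfDim Y k)
    (t : (Finset V →₀ K) ⊗[K] (Finset V →₀ K)) :
    strataHomotopy c (stratumIncl K σ.1 t) = stratumIncl K σ.1 ((c σ).h t) := by
  suffices h : strataHomotopy c ∘ₗ stratumIncl K σ.1 = stratumIncl K σ.1 ∘ₗ (c σ).h from
    LinearMap.congr_fun h t
  refine tensor_ext_single fun A B => ?_
  rw [LinearMap.comp_apply, LinearMap.comp_apply, stratumIncl_single, strataHomotopy,
    Finsupp.linearCombination_single, one_smul, dif_pos σ.2]

theorem strataHomotopy_eq_zero {n p m : ℤ} (hk : k < n - p)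
    {x : Finset V × Finset V × Finset V →₀ K} (hx : x ∈ filtChains K X Y n p m) :
    strataHomotopy c x = 0 := by
  refine (Submodule.mem_bot K).1 (map_mem_of_supported (fun t ht => ?_) hx)
  rw [Submodule.mem_bot, strataHomotopy, Finsupp.linearCombination_single, dif_neg, smul_zero]
  rintro ⟨-, h⟩
  have := ht.2
  linarith

/-- To check a property of a linear map on `filtChains`, it suffices to consider smaller
filtration and single strata. -/
theorem map_mem_of_filtChains {n p m : ℤ} (hk : k = n - p) {L : Type*} [AddCommGroup L]
    [Module K L] {R : Submodule K L} {f : (Finset V × Finset V × Finset V →₀ K) →ₗ[K] L}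
    (h₁ : ∀ x ∈ filtChains K X Y n (p - 1) m, f x ∈ R)
    (h₂ : ∀ σ : FacesOfDim Y k, ∀ t ∈ tensorGrading (relChains K X (LowerSet.Iic σ.1))
      (fun j => chains K (link Y σ.1) (j - 1)) m, f (stratumIncl K σ.1 t) ∈ R)
    {x : Finset V × Finset V × Finset V →₀ K} (hx : x ∈ filtChains K X Y n p m) : f x ∈ R := by
  refine map_mem_of_supported (fun t ht => ?_) hx
  obtain ⟨A, σ, B⟩ := t
  obtain ⟨⟨h3, h4⟩, h5⟩ := ht
  rcases h5.eq_or_lt with h6 | h6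
  · rw [← stratumIncl_single]
    exact h₂ ⟨σ, Y.lower Finset.subset_union_left h3.2.2.2, h6.symm.trans hk.symm⟩ _
      (single_mem_tensorGrading h3 h4)
  · exact h₁ _ (Finsupp.single_mem_supported K _ ⟨⟨h3, h4⟩, by dsimp only at h6 ⊢; lia⟩)

-- The difference is minus the upper-face part, which enlarges σ.
variable (K) in
theorem totalBoundary_stratumIncl_sub_mem {n p m : ℤ} {σ : Finset V} (hσ : σ ∈ Y)
    (hp : n - p ≤ simplexDim σ) {t : (Finset V →₀ K) ⊗[K] (Finset V →₀ K)}
    (ht : t ∈ tensorGrading (relChains K X (LowerSet.Iic σ))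
      (fun j => chains K (link Y σ) (j - 1)) (m + 1)) :
    totalBoundary K X (stratumIncl K σ t) -
      stratumIncl K σ (tensorDifferential (relBoundary K X) (signOp K) (boundary K) t) ∈
        filtChains K X Y n (p - 1) m := by
  rw [totalBoundary_eq, lowerMap_stratumIncl, sub_sub_cancel_left]
  exact neg_mem (upperMap_mem_filtChains (stratumIncl_mem hσ hp ht))

theorem totalBoundary_mem_filtChains {n p m : ℤ} {x : Finset V × Finset V × Finset V →₀ K}
    (hx : x ∈ filtChains K X Y n p (m + 1)) : totalBoundary K X x ∈ filtChains K X Y n p m := by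
  rw [totalBoundary_eq]
  exact sub_mem (lowerMap_mem_filtChains hx)
    (filtChains_mono K X Y n m (by lia : p - 1 ≤ p) (upperMap_mem_filtChains hx))

/-- The first page of the spectral sequence of the filtration by strata. -/
noncomputable def strataFirstPageEquiv {n p : ℤ} (hk : k = n - p) (q : ℤ) :
    ((filteredSpectralSequence (filtChains K X Y n) (totalBoundary_sq K X)
      (filtChains_mono K X Y n)).page 1 le_rfl).X (p, q) ≃ₗ[K] ⨁ σ, H σ (p + q) :=
  firstPageEquiv (totalBoundary_sq K X) (filtChains_mono K X Y n) p q _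
    (strataProj c (p + q)) (strataIncl c (p + q))
    (strataIncl_induction _ fun σ y => by
      rw [strataIncl_lof]
      exact stratumIncl_mem σ.2.1 (by rw [σ.2.2, hk]) ((c σ).ι_mem _ _))
    (strataIncl_induction (totalBoundary K X ∘ₗ strataIncl c (p + q)) fun σ y => by
      rw [LinearMap.comp_apply, strataIncl_lof]
      have h := totalBoundary_stratumIncl_sub_mem K (n := n) (p := p) (m := p + q - 1) σ.2.1
        (by rw [σ.2.2, hk]) (by rw [sub_add_cancel]; exact (c σ).ι_mem _ y)
      rwa [(c σ).d_ι, map_zero, sub_zero] at h)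
    (fun y => sub_eq_zero.1 ((Submodule.mem_bot K).1 (strataIncl_induction
      (strataProj c (p + q) ∘ₗ strataIncl c (p + q) - LinearMap.id) (fun σ y => by
        rw [Submodule.mem_bot, LinearMap.sub_apply, LinearMap.comp_apply, strataIncl_lof,
          strataProj_stratumIncl, (c σ).ρ_ι, LinearMap.id_apply, sub_self]) y)))
    (fun x hx => strataProj_eq_zero c _ (by lia) hx)
    (fun x hx => (Submodule.mem_bot K).1 (map_mem_of_filtChains hk
      (f := strataProj c (p + q) ∘ₗ totalBoundary K X)
      (fun x hx => (Submodule.mem_bot K).2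
        (strataProj_eq_zero c _ (by lia) (totalBoundary_mem_filtChains hx)))
      (fun σ t ht => by
        have h := strataProj_eq_zero c (p + q) (by lia)
          (totalBoundary_stratumIncl_sub_mem K (n := n) (p := p) σ.2.1 (by rw [σ.2.2, hk]) ht)
        rw [map_sub, strataProj_stratumIncl, (c σ).ρ_d _ t ht, map_zero, sub_zero] at h
        rwa [Submodule.mem_bot]) hx))
    (fun x hx hdx => by
      refine ⟨strataHomotopy c x, map_mem_of_filtChains hk (fun x hx => ?_) (fun σ t ht => ?_) hx,
        ?_⟩
      · rw [strataHomotopy_eq_zero c (by lia) hx]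
        exact zero_mem _
      · rw [strataHomotopy_stratumIncl]
        exact stratumIncl_mem σ.2.1 (by rw [σ.2.2, hk]) ((c σ).h_mem _ t ht)
      -- The boundary of x involves only σ of dimension greater than k, where the homotopy is zero;
      -- so the term h d x drops out of the relation below.
      · have hz := strataHomotopy_eq_zero c (by lia) hdx
        -- The homotopy relation modulo filtration p - 1. On a stratum it is the relation of the
        -- contraction, up to the upper faces ignored by the tensor differential.
        have key : (LinearMap.id - strataIncl c (p + q) ∘ₗ strataProj c (p + q) -
            totalBoundary K X ∘ₗ strataHomotopy c - strataHomotopy c ∘ₗ totalBoundary K X :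
              _ →ₗ[K] _) x ∈ filtChains K X Y n (p - 1) (p + q) := by
          refine map_mem_of_filtChains hk (fun x hx => ?_) (fun σ t ht => ?_) hx
          · have hx' : totalBoundary K X x ∈ filtChains K X Y n (p - 1) (p + q - 1) :=
              totalBoundary_mem_filtChains (by rwa [sub_add_cancel])
            simp only [LinearMap.sub_apply, LinearMap.comp_apply, LinearMap.id_apply]
            rw [strataProj_eq_zero c _ (by lia) hx, strataHomotopy_eq_zero c (by lia) hx,
              strataHomotopy_eq_zero c (by lia) hx', map_zero, map_zero, sub_zero, sub_zero,
              sub_zero]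
            exact hx
          · have h1 := totalBoundary_stratumIncl_sub_mem K (n := n) (p := p) σ.2.1
              (by rw [σ.2.2, hk]) ((c σ).h_mem _ t ht)
            have h2 := strataHomotopy_eq_zero c (by lia)
              (totalBoundary_stratumIncl_sub_mem K (n := n) (p := p) (m := p + q - 1) σ.2.1
                (by rw [σ.2.2, hk]) (by rwa [sub_add_cancel]))
            rw [map_sub, strataHomotopy_stratumIncl, sub_eq_zero] at h2
            have h3 := congrArg (stratumIncl K σ.1) ((c σ).homotopy _ t ht)
            rw [map_sub, map_add] at h3
            simp only [LinearMap.sub_apply, LinearMap.comp_apply, LinearMap.id_apply]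
            rw [strataProj_stratumIncl, strataIncl_lof, strataHomotopy_stratumIncl, h2, h3]
            convert neg_mem h1 using 1
            abel
        simp only [LinearMap.sub_apply, LinearMap.comp_apply, LinearMap.id_apply] at key
        rwa [hz, sub_zero] at key)

end FirstPage

end SimplicialHomology

/-! ### The proposition. -/

open scoped DirectSum TensorProduct in
theorem proposition2p1 (K : Type u) [Field K] {V : Type v} [LinearOrder V]
    (X Y : SimplicialHomology.Complex V) (hX : ∅ ∈ X)
    (n : ℤ) (hn : SimplicialHomology.HasDim Y n) :
    ∃ E : SimplicialHomology.HomologySpectralSequence.{u, max u v} K,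
      SimplicialHomology.ConvergesTo E
        (fun m => SimplicialHomology.relativeHomology K (inf_le_right : X ⊓ Y ≤ Y) m) ∧
      (∀ p q : ℤ, 0 ≤ p → p ≤ n →
        Nonempty ((E.page 1 le_rfl).X (p, q) ≃ₗ[K]
          ⨁ σ : SimplicialHomology.FacesOfDim Y (n - p),
            ⨁ ij : {ij : ℕ × ℕ // (ij.1 : ℤ) + (ij.2 : ℤ) = p + q},
              SimplicialHomology.reducedHomology K
                  (SimplicialHomology.induced X σ.1) ((ij.1.1 : ℤ) - 1) ⊗[K]
                SimplicialHomology.reducedHomology K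
                  (SimplicialHomology.link Y σ.1) ((ij.1.2 : ℤ) - 1))) ∧
      (∀ p q : ℤ, p < 0 ∨ n < p → Limits.IsZero ((E.page 1 le_rfl).X (p, q))) := by
  open SimplicialHomology in
  refine ⟨filteredSpectralSequence (filtChains K X Y n) (totalBoundary_sq K X)
    (filtChains_mono K X Y n), ?_, fun p q hp hpn => ?_, fun p q h => ?_⟩
  · refine filteredSpectralSequence_convergesTo _ _ 0 n
      (fun p m hp => filtChains_eq_bot K X hn hp m) (fun p m hp => ?_) _ fun m => ?_
    · rw [filtChains_eq_totalChains K hX Y hp, filtChains_eq_totalChains K hX Y le_rfl]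
    · rw [filtChains_eq_totalChains K hX Y le_rfl, filtChains_eq_totalChains K hX Y le_rfl]
      exact (nonempty_totalHomology_equiv K X Y m).some.trans
        (nonempty_relativeHomology_equiv K X Y m).some
  -- From p ≤ n follows dim σ ≥ 0; nonemptiness of σ is what makes the full simplex on it acyclic.
  · have hne : ∀ σ : FacesOfDim Y (n - p), σ.1.Nonempty := fun σ => by
      have := σ.2.2
      simp only [simplexDim] at this
      exact Finset.card_pos.1 (by omega)
    exact ⟨strataFirstPageEquiv
      (fun σ => (nonempty_stratumContraction K hX (link Y σ.1) (hne σ)).some) rfl q⟩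
  · rcases h with h | h
    · exact isZero_page_of_eq_bot _ _ p q fun m => filtChains_eq_bot K X hn h m
    -- For p > n also p - 1 ≥ n, so both filtration steps are the whole complex.
    · refine isZero_page_of_eq_pred _ _ p q fun m => ?_
      rw [filtChains_eq_totalChains K hX Y h.le, filtChains_eq_totalChains K hX Y (by lia)]
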